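/- An $n$-dimensional (closed) simplicial pseudomanifold is a finite, nonempty simplicial complex $M$ that is the union of its $n$-simplices (called bricks), in which each $(n-1)$-face (called a facet) lies in exactly two bricks, and in which the graph whose vertices are the bricks, two distinct bricks being adjacent when they share a facet, is connected. Let $N$ be the number of bricks of $M$. An ordering of $M$ is a bijection $\mathcal O$ from the set of bricks to $\{1,\dots,N\}$. For $0\le j\le N$ let $\Lambda(j)$ be the number of facets that lie both in a brick $T$ with $\mathcal O(T)\le j$ and in a brick $T'$ with $\mathcal O(T')>j$. An index $t\in\{1,\dots,N-1\}$ is a maximum of $\mathcal O$ if there are $t_-,t_+\in\{0,\dots,N\}$ with $t_-<t<t_+$, $\Lambda(t_-)<\Lambda(t_-+1)$, $\Lambda(t_+)<\Lambda(t_+-1)$ and $\Lambda(k)=\Lambda(t)$ for all $t_-<k<t_+$. The width $\Omega(\mathcal O)$ is the sequence of the values of $\Lambda$ at the maxima of $\mathcal O$, with repetitions, arranged in non-increasing order. Widths are compared lexicographically, a proper initial segment being smaller. The width $\Omega(M)$ is the least width of an ordering of $M$. For two widths $a,b$, let $a\cup b$ be the sequence consisting of all terms of $a$ and of $b$, with repetitions,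 arranged in non-increasing order. Given $n$-dimensional pseudomanifolds $V_1,V_2$, taken disjoint, a connected sum $V_1\# V_2$ is a simplicial complex obtained by choosing bricks $C_1$ of $V_1$ and $C_2$ of $V_2$, removing (the interior of) $C_i$ from $V_i$ for $i=1,2$, and gluing the two remaining complexes along a simplicial homeomorphism $\partial C_1\to\partial C_2$. **Corollary.** Let $n\ge 2$ be even and let $V_1$, $V_2$ be closed $n$-dimensional simplicial pseudomanifolds. Then there is a connected sum $V_1\# V_2$, again an $n$-dimensional simplicial pseudomanifold, such that $$\max(\Omega(V_1),\Omega(V_2))\ \le\ \Omega(V_1\# V_2)\ \le\ \Omega(V_1)\cup\Omega(V_2).$$ -/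

import Mathlib

/-! Pseudomanifolds are finite (abstract) simplicial complexes, given by their nonempty finite faces.
The vertices of `K` are the `v` with `{v} ∈ K`; other elements of the index type play no role. -/

namespace PreAbstractSimplicialComplex

universe u v

variable {α : Type u} {β : Type v}

/-- The bricks of `K`: its `n`-dimensional simplices. -/
def bricks (K : PreAbstractSimplicialComplex α) (n : ℕ) : Set (Finset α) :=
  {T | T ∈ K ∧ T.card = n + 1}

/-- The facets of `K`: its `(n-1)`-dimensional simplices. -/
def facets (K : PreAbstractSimplicialComplex α) (n : ℕ) : Set (Finset α) :=
  {F | F ∈ K ∧ F.card = n}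

/-- The graph on the `n`-simplices, two distinct ones being joined when they share an
`(n-1)`-face. -/
def dualGraph (K : PreAbstractSimplicialComplex α) (n : ℕ) : SimpleGraph (K.bricks n) where
  Adj T T' := T ≠ T' ∧ ∃ F ∈ K.facets n, F ⊆ T.1 ∧ F ⊆ T'.1
  symm := ⟨fun _ _ h => ⟨h.1.symm, h.2.imp fun _ hF => ⟨hF.1, hF.2.2, hF.2.1⟩⟩⟩
  loopless := ⟨fun _ h => h.1 rfl⟩

/-- (Closed) `n`-dimensional simplicial pseudomanifolds. -/
structure IsPseudomanifold (K : PreAbstractSimplicialComplex α) (n : ℕ) : Prop where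
  finite : K.faces.Finite
  nonempty : (K.bricks n).Nonempty
  /-- `K` is the union of its `n`-simplices (so it has no simplex of dimension above `n`). -/
  exists_brick : ∀ s ∈ K, ∃ T ∈ K.bricks n, s ⊆ T
  /-- Each `(n-1)`-face is incident to exactly two `n`-simplices. -/
  two_bricks : ∀ F ∈ K.facets n, {T | T ∈ K.bricks n ∧ F ⊆ T}.ncard = 2
  stronglyConnected : (K.dualGraph n).Connected

/-! ### Orderings and width -/

/-- An ordering of the `N` bricks. Positions are counted from `0`: the brick `T` is the one of
height `O T + 1`. -/
abbrev Ordering (K : PreAbstractSimplicialComplex α) (n : ℕ) : Type u :=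
  K.bricks n ≃ Fin (Nat.card (K.bricks n))

namespace Ordering

variable {K : PreAbstractSimplicialComplex α} {n : ℕ}

/-- The level set at height `j`: the facets that lie both in one of the first `j` bricks and in one
of the remaining bricks. -/
def levelSet (O : K.Ordering n) (j : ℕ) : Set (Finset α) :=
  {F | F ∈ K.facets n ∧ (∃ T, (O T : ℕ) < j ∧ F ⊆ T.1) ∧ ∃ T, j ≤ (O T : ℕ) ∧ F ⊆ T.1}

/-- The weight `Λ(j)` of the level set at height `j`, each facet having weight `1`. -/
noncomputable def level (O : K.Ordering n) (j : ℕ) : ℕ :=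
  (O.levelSet j).ncard

/-- `t` is a (local) maximum of the ordering; plateaus are allowed. -/
def IsMaximum (O : K.Ordering n) (t : ℕ) : Prop :=
  1 ≤ t ∧ t ≤ Nat.card (K.bricks n) - 1 ∧
    ∃ a b : ℕ, a < t ∧ t < b ∧ b ≤ Nat.card (K.bricks n) ∧
      O.level a < O.level (a + 1) ∧ O.level b < O.level (b - 1) ∧
      ∀ k, a < k → k < b → O.level t = O.level k

open Classical in
/-- The width of an ordering: the values of `Λ` at its maxima, with repetitions, arranged in
non-increasing order. Lists carry the lexicographic order, a proper prefix being smaller. -/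
noncomputable def width (O : K.Ordering n) : List ℕ :=
  (((Finset.Icc 1 (Nat.card (K.bricks n) - 1)).filter O.IsMaximum).val.map O.level).sort (· ≥ ·)

end Ordering

namespace IsPseudomanifold

variable {K : PreAbstractSimplicialComplex α} {n : ℕ}

theorem nonempty_ordering (h : K.IsPseudomanifold n) : Nonempty (K.Ordering n) := by
  have : Finite (K.bricks n) := (h.finite.subset fun _ hT => hT.1).to_subtype
  exact ⟨Finite.equivFin _⟩

/-- The width `Ω` of a pseudomanifold: the lexicographically least width of an ordering. -/
noncomputable def width (h : K.IsPseudomanifold n) : List ℕ :=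
  letI := Fintype.ofFinite (K.Ordering n)
  (Finset.univ : Finset (K.Ordering n)).inf'
    (Finset.univ_nonempty_iff.2 h.nonempty_ordering) fun O => O.width

end IsPseudomanifold

/-! ### Connected sums -/

/-- The complex obtained by removing (the interior of) the simplex `C` and any simplex having `C` as
a face; when `C` is a brick, only `C` itself is removed. -/
def remove (K : PreAbstractSimplicialComplex α) (C : Finset α) :
    PreAbstractSimplicialComplex α where
  faces := {s | s ∈ K ∧ ¬ C ⊆ s}
  isRelLowerSet_faces := fun _ hs =>
    ⟨(K.isRelLowerSet_faces hs.1).1, fun _ hts ht =>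
      ⟨(K.isRelLowerSet_faces hs.1).2 hts ht, fun hC => hs.2 (hC.trans hts)⟩⟩

open Classical in
/-- The vertices of the second complex inside the glued vertex set, in which the vertices of `C₂` are
identified with those of `C₁` through `φ`. -/
noncomputable def glueVertex {C₁ : Finset α} {C₂ : Finset β} (φ : C₁ ≃ C₂) (b : β) :
    α ⊕ {b : β // b ∉ C₂} :=
  if hb : b ∈ C₂ then Sum.inl (φ.symm ⟨b, hb⟩).1 else Sum.inr ⟨b, hb⟩

open Classical in
/-- The connected sum of `K₁` and `K₂` along the bricks `C₁` and `C₂`: remove the two bricks from the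
(disjoint) complexes and glue along the simplicial homeomorphism `∂C₁ → ∂C₂` given by the bijection
`φ` between the vertices. -/
noncomputable def connectedSum (K₁ : PreAbstractSimplicialComplex α)
    (K₂ : PreAbstractSimplicialComplex β) {C₁ : Finset α} {C₂ : Finset β} (φ : C₁ ≃ C₂) :
    PreAbstractSimplicialComplex (α ⊕ {b : β // b ∉ C₂}) :=
  (K₁.remove C₁).map Sum.inl ⊔ (K₂.remove C₂).map (glueVertex φ)

/-- The union of two widths: all terms of both, arranged in non-increasing order. -/
def widthUnion (a b : List ℕ) : List ℕ :=
  ((a : Multiset ℕ) + (b : Multiset ℕ)).sort (· ≥ ·)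

end PreAbstractSimplicialComplex

/-!
Since `n` is even, a brick has an odd number `n + 1` of facets, so adding a brick always changes the
level. Hence orderings have no plateaus, and the width is the sorted multiset of the values at the
strict local maxima, the peaks (`Ordering.width_eq_sort_peaks`). Sorted multisets compare like
their multiplicities read from the largest value down (`Multiset.sort_ge_lt_sort_ge`), so that one
peak outweighs any number of lower ones.

Both complexes are first moved injectively into the glued vertex set, where they have exactly the
brick `C` and its faces in common (`MeetAlong`); the connected sum is their union without `C`. The
cut of a set of bricks in the connected sum is the symmetric difference of its cuts in `K₁` and `K₂`
(`MeetAlong.cutSet_glue`).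

*Upper bound.* Take for `C` the last brick of an optimal ordering of `K₁` and the first brick of an
optimal ordering of `K₂`. In the concatenated ordering the junction has level `n + 1` and is a local
minimum on both sides, so the peaks are those of the two orderings together
(`MeetAlong.width_le_widthUnion`).

*Lower bound.* This holds for every choice of `C`. Let `X` be a set of bricks of the connected sum,
and let `k` of the `n + 1` bricks of `K₂` next to `C` belong to `X`. If one of two such bricks is in
`X` and the other is not, look at the simplex of codimension two in which the two facets of `C` meet:
a cut contains an even number of facets around it, so some facet around it but off `C` is cut as
well. Thus at least `k * (n + 1 - k)` facets of `K₂` off `C` are cut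
(`IsPseudomanifold.ncard_mul_ncard_le_ncard_cutSet`), and for `k = 0` and `k = n + 1` some facet off
`C` is still cut by strong connectedness, unless `X` contains none or all of these bricks.
Consequently, if `C` counts as belonging to
`X` once `k ≥ 2`, and `X` contains some but not all of the bricks of `K₂`, then the cut in `K₁` is
strictly smaller than the cut in the connected sum. So an ordering of the connected sum induces one
of `K₁` with the same levels before the first and after the last brick of `K₂`, and strictly smaller
ones in between. As the first brick of `K₂` raises the level and the last one lowers it, the largest
level in between is a peak exceeding everything that replaces it, and the width has decreased
(`sort_peaks_lt_sort_peaks`, `MeetAlong.exists_ordering_width_lt`).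
-/

/-! ### Sorted multisets and peaks of sequences -/

namespace Multiset

/-- Non-increasing arrangements compare lexicographically like multiplicities read from the top:
the first value `P` whose multiplicities differ decides. -/
theorem sort_ge_lt_sort_ge {S T : Multiset ℕ} (P : ℕ)
    (habove : ∀ x, P < x → S.count x = T.count x) (hP : S.count P < T.count P) :
    S.sort (· ≥ ·) < T.sort (· ≥ ·) := by
  have key : ∀ R : Multiset ℕ, R.sort (· ≥ ·) =
      (R.filter (P < ·)).sort (· ≥ ·) ++
        (List.replicate (R.count P) P ++ (R.filter (· < P)).sort (· ≥ ·)) := by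
    intro R
    apply List.Perm.eq_of_pairwise' (r := (· ≥ ·))
    · exact Multiset.pairwise_sort _ _
    · rw [List.pairwise_append, List.pairwise_append]
      refine ⟨Multiset.pairwise_sort _ _, ⟨?_, Multiset.pairwise_sort _ _, ?_⟩, ?_⟩
      · exact List.pairwise_replicate.2 (Or.inr le_rfl)
      · intro a ha b hb
        rw [Multiset.mem_sort, Multiset.mem_filter] at hb
        rw [List.eq_of_mem_replicate ha]
        exact hb.2.le
      · intro a ha b hb
        rw [Multiset.mem_sort, Multiset.mem_filter] at ha
        rw [List.mem_append] at hb
        rcases hb with hb | hb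
        · rw [List.eq_of_mem_replicate hb]
          exact ha.2.le
        · rw [Multiset.mem_sort, Multiset.mem_filter] at hb
          exact (hb.2.trans ha.2).le
    · rw [← Multiset.coe_eq_coe, ← Multiset.coe_add, ← Multiset.coe_add, Multiset.sort_eq,
        Multiset.sort_eq, Multiset.sort_eq, Multiset.coe_replicate]
      ext x
      rw [Multiset.count_add, Multiset.count_add, Multiset.count_filter, Multiset.count_filter,
        Multiset.count_replicate]
      rcases lt_trichotomy x P with h | rfl | h
      · simp [h, h.ne', h.not_gt]
      · simp
      · simp [h, h.ne, h.not_gt]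
  have hfil : S.filter (P < ·) = T.filter (P < ·) := by
    ext x
    rw [Multiset.count_filter, Multiset.count_filter]
    split_ifs with h
    · exact habove x h
    · rfl
  rw [key S, key T, hfil]
  apply List.append_left_lt
  obtain ⟨d, hd⟩ := Nat.exists_eq_add_of_lt hP
  rw [hd, add_assoc, List.replicate_add, List.append_assoc]
  apply List.append_left_lt
  rw [List.replicate_succ, List.cons_append]
  rcases hR : (S.filter (· < P)).sort (· ≥ ·) with _ | ⟨y, l⟩
  · exact List.nil_lt_cons _ _
  · have hy : y ∈ (S.filter (· < P)).sort (· ≥ ·) := by rw [hR]; exact List.mem_cons_self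
    rw [Multiset.mem_sort, Multiset.mem_filter] at hy
    exact List.cons_lt_cons_iff.2 (Or.inl hy.2)

end Multiset

/-- The multiset of the values of `L` at its strict local maxima at the positions
`a + 1, …, b`. -/
def peaks (L : ℕ → ℕ) (a b : ℕ) : Multiset ℕ :=
  ∑ t ∈ Finset.Ico a b, if L t < L (t + 1) ∧ L (t + 2) < L (t + 1) then {L (t + 1)} else 0

theorem mem_peaks {L : ℕ → ℕ} {a b x : ℕ} :
    x ∈ peaks L a b ↔
      ∃ t, a ≤ t ∧ t < b ∧ L t < L (t + 1) ∧ L (t + 2) < L (t + 1) ∧ x = L (t + 1) := by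
  simp only [peaks, Multiset.mem_sum, Finset.mem_Ico]
  constructor
  · rintro ⟨t, ⟨h1, h2⟩, hx⟩
    split_ifs at hx with h
    · exact ⟨t, h1, h2, h.1, h.2, Multiset.mem_singleton.1 hx⟩
    · exact absurd hx (Multiset.notMem_zero _)
  · rintro ⟨t, h1, h2, h3, h4, rfl⟩
    exact ⟨t, ⟨h1, h2⟩, by simp [h3, h4]⟩

theorem peaks_add_peaks (L : ℕ → ℕ) {a b c : ℕ} (hab : a ≤ b) (hbc : b ≤ c) :
    peaks L a b + peaks L b c = peaks L a c :=
  Finset.sum_Ico_consecutive _ hab hbc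

theorem peaks_self (L : ℕ → ℕ) (a : ℕ) : peaks L a a = 0 := by
  simp [peaks]

theorem peaks_succ_of_not (L : ℕ → ℕ) {a : ℕ} (h : ¬ (L a < L (a + 1) ∧ L (a + 2) < L (a + 1))) :
    peaks L a (a + 1) = 0 := by
  simp [peaks, h]

theorem peaks_shift {f g : ℕ → ℕ} {s t k : ℕ} (h : ∀ i, i ≤ k + 1 → g (s + i) = f (t + i)) :
    peaks g s (s + k) = peaks f t (t + k) := by
  unfold peaks
  rw [Finset.sum_Ico_eq_sum_range, Finset.sum_Ico_eq_sum_range, Nat.add_sub_cancel_left,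
    Nat.add_sub_cancel_left]
  refine Finset.sum_congr rfl fun i hi => ?_
  rw [Finset.mem_range] at hi
  have h1 := h (i + 1) (by omega)
  have h2 := h (i + 2) (by omega)
  simp only [← add_assoc] at h1 h2
  rw [h i (by omega), h1, h2]

/-- If `f` and `g` agree before an ascent of `f` at `t₁` and after a descent of `f` at `t₂`, and
every value of `g` in between lies strictly below some value of `f` in between, then the peaks of `g`
are lexicographically smaller: the largest peak of `f` in between beats all of those of `g`. -/
theorem sort_peaks_lt_sort_peaks {f g : ℕ → ℕ} {t₁ t₂ s₂ N N₁ : ℕ} (h12 : t₁ < t₂) (h2N : t₂ < N)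
    (hs : t₁ ≤ s₂) (hN : N₁ + (t₂ + 1) = s₂ + N) (hne : ∀ t < N, f t ≠ f (t + 1))
    (hup : f t₁ < f (t₁ + 1)) (hdown : f (t₂ + 1) < f t₂) (hleft : ∀ t ≤ t₁, g t = f t)
    (hright : ∀ i, g (s₂ + i) = f (t₂ + 1 + i))
    (hmid : ∀ s, t₁ < s → s < s₂ → ∃ t, t₁ < t ∧ t ≤ t₂ ∧ g s < f t) :
    (peaks g 0 N₁).sort (· ≥ ·) < (peaks f 0 N).sort (· ≥ ·) := by
  obtain ⟨m, hm, hmax⟩ := Finset.exists_max_image (Finset.Icc (t₁ + 1) t₂) f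
    ⟨t₂, Finset.mem_Icc.2 ⟨h12, le_rfl⟩⟩
  rw [Finset.mem_Icc] at hm
  have hmax' : ∀ t, t₁ < t → t ≤ t₂ → f t ≤ f m := fun t h h' =>
    hmax t (Finset.mem_Icc.2 ⟨h, h'⟩)
  have hf1 : f t₁ < f m := hup.trans_le (hmax' _ (Nat.lt_succ_self _) h12)
  have hf2 : f (t₂ + 1) < f m := hdown.trans_le (hmax' _ h12 le_rfl)
  have hfle : ∀ t, t₁ ≤ t → t ≤ t₂ + 1 → f t ≤ f m := by
    intro t ha hb
    rcases ha.eq_or_lt with rfl | ha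
    · exact hf1.le
    rcases hb.eq_or_lt with rfl | hb
    · exact hf2.le
    exact hmax' t ha (by omega)
  have hglt : ∀ s, t₁ ≤ s → s ≤ s₂ → g s < f m := by
    intro s ha hb
    rcases ha.eq_or_lt with rfl | ha
    · rw [hleft _ le_rfl]; exact hf1
    rcases hb.eq_or_lt with rfl | hb
    · have := hright 0
      simp only [add_zero] at this
      rw [this]; exact hf2
    obtain ⟨t, h1, h2, h3⟩ := hmid s ha hb
    exact h3.trans_le (hmax' t h1 h2)
  have hg : peaks g 0 N₁ = peaks f 0 (t₁ - 1) + peaks g (t₁ - 1) s₂ + peaks f (t₂ + 1) N := by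
    have e1 : peaks g 0 (t₁ - 1) = peaks f 0 (t₁ - 1) := by
      rcases Nat.eq_zero_or_pos t₁ with h0 | h0
      · simp only [h0, Nat.zero_sub, peaks_self]
      · have := peaks_shift (f := f) (g := g) (s := 0) (t := 0) (k := t₁ - 1) (fun i hi => by
          simpa using hleft i (by omega))
        simpa using this
    have e2 : peaks g s₂ N₁ = peaks f (t₂ + 1) N := by
      have := peaks_shift (f := f) (g := g) (s := s₂) (t := t₂ + 1) (k := N - (t₂ + 1))
        (fun i _ => hright i)
      rwa [show s₂ + (N - (t₂ + 1)) = N₁ by omega, show t₂ + 1 + (N - (t₂ + 1)) = N by omega]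
        at this
    rw [← e1, ← e2, peaks_add_peaks g (by omega) (by omega), peaks_add_peaks g (by omega) (by omega)]
  have hf : peaks f 0 N = peaks f 0 (t₁ - 1) + peaks f (t₁ - 1) (t₂ + 1) + peaks f (t₂ + 1) N := by
    rw [← peaks_add_peaks f (a := 0) (b := t₂ + 1) (by omega) (by omega),
      ← peaks_add_peaks f (a := 0) (b := t₁ - 1) (by omega) (by omega)]
  have hgm : ∀ x ∈ peaks g (t₁ - 1) s₂, x < f m := by
    intro x hx
    obtain ⟨t, h1, h2, -, -, rfl⟩ := mem_peaks.1 hx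
    exact hglt _ (by omega) (by omega)
  have hfm : ∀ x ∈ peaks f (t₁ - 1) (t₂ + 1), x ≤ f m := by
    intro x hx
    obtain ⟨t, h1, h2, -, -, rfl⟩ := mem_peaks.1 hx
    exact hfle _ (by omega) (by omega)
  have hmem : f m ∈ peaks f (t₁ - 1) (t₂ + 1) := by
    obtain ⟨u, rfl⟩ : ∃ u, m = u + 1 := ⟨m - 1, by omega⟩
    exact mem_peaks.2 ⟨u, by omega, by omega,
      lt_of_le_of_ne (hfle _ (by omega) (by omega)) (hne u (by omega)),
      lt_of_le_of_ne (hfle _ (by omega) (by omega)) (hne (u + 1) (by omega)).symm, rfl⟩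
  -- The largest value of `f` in between is the first one whose multiplicities differ.
  apply Multiset.sort_ge_lt_sort_ge (f m)
  · intro x hx
    rw [hg, hf]
    simp only [Multiset.count_add]
    rw [Multiset.count_eq_zero_of_notMem fun h => (hgm x h).not_gt hx,
      Multiset.count_eq_zero_of_notMem fun h => (hfm x h).not_gt hx]
  · rw [hg, hf]
    simp only [Multiset.count_add]
    rw [Multiset.count_eq_zero_of_notMem fun h => (hgm _ h).false]
    have := Multiset.count_pos.2 hmem
    omega

/-- Concatenation at a common local minimum: the peaks of the concatenation are those of the two
parts. -/
theorem peaks_concat {f g₁ g₂ : ℕ → ℕ} {p q : ℕ} (hp : 1 ≤ p)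
    (hleft : ∀ j ≤ p, f j = g₁ j) (hright : ∀ i, f (p + i) = g₂ (1 + i))
    (h₁ : g₁ p < g₁ (p - 1)) (h₁' : g₁ (p + 1) < g₁ p) (h₂ : g₂ 1 < g₂ 2) :
    peaks f 0 (p + q) = peaks g₁ 0 (p + 1) + peaks g₂ 0 (q + 1) := by
  obtain ⟨r, rfl⟩ : ∃ r, p = r + 1 := ⟨p - 1, by omega⟩
  simp only [Nat.add_sub_cancel] at h₁
  have e1 : peaks f 0 r = peaks g₁ 0 r := by
    have := peaks_shift (f := g₁) (g := f) (s := 0) (t := 0) (k := r) (fun i hi => by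
      simpa using hleft i hi)
    simpa using this
  have e2 : peaks f (r + 1) (r + 1 + q) = peaks g₂ 1 (q + 1) := by
    rw [add_comm q 1]
    exact peaks_shift fun i _ => hright i
  have e3 : peaks f r (r + 1) = 0 := by
    apply peaks_succ_of_not
    rw [hleft r (by omega), hleft (r + 1) le_rfl]
    exact fun h => h₁.not_gt h.1
  have e4 : peaks g₁ r (r + 1) = 0 := peaks_succ_of_not _ fun h => h₁.not_gt h.1
  have e5 : peaks g₁ (r + 1) (r + 1 + 1) = 0 := peaks_succ_of_not _ fun h => h₁'.not_gt h.1
  have e6 : peaks g₂ 0 1 = 0 := peaks_succ_of_not _ fun h => h₂.not_gt h.2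
  rw [← peaks_add_peaks f (Nat.zero_le (r + 1)) (by omega), ← peaks_add_peaks f (Nat.zero_le r)
    (by omega), ← peaks_add_peaks g₁ (Nat.zero_le (r + 1)) (by omega),
    ← peaks_add_peaks g₁ (Nat.zero_le r) (by omega),
    ← peaks_add_peaks g₂ (Nat.zero_le 1) (by omega), e1, e2, e3, e4, e5, e6]
  simp

/-! ### Cuts in pseudomanifolds -/

namespace PreAbstractSimplicialComplex

universe u

variable {α : Type u}

/-- The facets separating the bricks in `X` from those outside `X`. Only the bricks in `X` matter,
so that `X` may be any set of finsets. -/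
def cutSet (K : PreAbstractSimplicialComplex α) (n : ℕ) (X : Set (Finset α)) : Set (Finset α) :=
  {F | F ∈ K.facets n ∧ (∃ T ∈ K.bricks n, T ∈ X ∧ F ⊆ T) ∧ ∃ T ∈ K.bricks n, T ∉ X ∧ F ⊆ T}

/-- The number of facets separating the bricks in `X` from those outside `X`. -/
noncomputable def cut (K : PreAbstractSimplicialComplex α) (n : ℕ) (X : Set (Finset α)) : ℕ :=
  (K.cutSet n X).ncard

variable {K : PreAbstractSimplicialComplex α} {n : ℕ}

theorem cutSet_subset_facets (X : Set (Finset α)) : K.cutSet n X ⊆ K.facets n := fun _ h => h.1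

theorem cutSet_congr {X Y : Set (Finset α)} (h : ∀ T ∈ K.bricks n, (T ∈ X ↔ T ∈ Y)) :
    K.cutSet n X = K.cutSet n Y := by
  ext F
  refine and_congr Iff.rfl (and_congr (exists_congr fun T => ?_) (exists_congr fun T => ?_))
  · exact and_congr_right fun hT => by rw [h T hT]
  · exact and_congr_right fun hT => by rw [h T hT]

theorem cutSet_compl (X : Set (Finset α)) : K.cutSet n Xᶜ = K.cutSet n X := by
  ext F
  simp only [cutSet, Set.mem_ofPred_eq, Set.mem_compl_iff, not_not]
  tauto

theorem mem_facets_of_subset (hn : 1 ≤ n) {F T : Finset α} (hT : T ∈ K) (hF : F.card = n)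
    (hFT : F ⊆ T) : F ∈ K.facets n :=
  ⟨(K.isRelLowerSet_faces hT).2 hFT (Finset.card_pos.1 (by omega)), hF⟩

/-- Two distinct simplices of dimension `n` share at most one facet. -/
theorem eq_of_common_facets {F F' T T' : Finset α} (hT : T.card = n + 1) (hT' : T'.card = n + 1)
    (hF : F.card = n) (hF' : F'.card = n) (hne : F ≠ F') (h1 : F ⊆ T) (h2 : F' ⊆ T) (h3 : F ⊆ T')
    (h4 : F' ⊆ T') : T = T' := by
  classical
  have hlt : n < (F ∪ F').card := by
    rw [← hF]
    refine Finset.card_lt_card (Finset.ssubset_iff_subset_ne.2 ⟨Finset.subset_union_left, ?_⟩)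
    intro h
    have hsub : F' ⊆ F := by rw [h]; exact Finset.subset_union_right
    exact hne (Finset.eq_of_subset_of_card_le hsub (by omega)).symm
  rw [← Finset.eq_of_subset_of_card_le (Finset.union_subset h1 h2) (by omega),
    Finset.eq_of_subset_of_card_le (Finset.union_subset h3 h4) (by omega)]

/-- In a simplex of dimension `n`, only two facets contain the intersection of two facets. -/
theorem eq_or_eq_of_inter_subset [DecidableEq α] {F F' G T : Finset α} (hT : T.card = n + 1)
    (hF : F.card = n) (hF' : F'.card = n) (hG : G.card = n) (h1 : F ⊆ T) (h2 : F' ⊆ T)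
    (h3 : G ⊆ T) (h : F ∩ F' ⊆ G) : G = F ∨ G = F' := by
  by_contra hcon
  push Not at hcon
  have sd : ∀ {H : Finset α}, H.card = n → H ⊆ T → ∃ x, T \ H = {x} := fun {H} hH hHT => by
    rw [← Finset.card_eq_one, Finset.card_sdiff_of_subset hHT]; omega
  obtain ⟨x, hx⟩ := sd hF h1
  obtain ⟨y, hy⟩ := sd hF' h2
  obtain ⟨z, hz⟩ := sd hG h3
  have back : ∀ {H H' : Finset α} {x : α}, H ⊆ T → H' ⊆ T → T \ H = {x} → T \ H' = {x} → H = H' :=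
    fun {H H' x} hH hH' e e' => by
      rw [← Finset.sdiff_sdiff_eq_self hH, ← Finset.sdiff_sdiff_eq_self hH', e, e']
  have hzT : z ∈ T \ G := by rw [hz]; exact Finset.mem_singleton_self z
  rw [Finset.mem_sdiff] at hzT
  apply hzT.2
  apply h
  rw [Finset.mem_inter]
  constructor
  · by_contra hzF
    have : z ∈ T \ F := Finset.mem_sdiff.2 ⟨hzT.1, hzF⟩
    rw [hx, Finset.mem_singleton] at this
    subst this
    exact hcon.1 (back h3 h1 hz hx)
  · by_contra hzF
    have : z ∈ T \ F' := Finset.mem_sdiff.2 ⟨hzT.1, hzF⟩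
    rw [hy, Finset.mem_singleton] at this
    subst this
    exact hcon.2 (back h3 h2 hz hy)

theorem card_inter_facets [DecidableEq α] {F F' T : Finset α} (hT : T.card = n + 1)
    (hF : F.card = n) (hF' : F'.card = n) (h1 : F ⊆ T) (h2 : F' ⊆ T) (hne : F ≠ F') :
    (F ∩ F').card + 1 = n := by
  have h := Finset.card_union_add_card_inter F F'
  have hle : (F ∪ F').card ≤ n + 1 := hT ▸ Finset.card_le_card (Finset.union_subset h1 h2)
  have hlt : (F ∩ F').card < n := by
    rw [← hF]
    refine Finset.card_lt_card (Finset.ssubset_iff_subset_ne.2 ⟨Finset.inter_subset_left, ?_⟩)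
    intro h
    exact hne (Finset.eq_of_subset_of_card_le (Finset.inter_eq_left.1 h) (by omega))
  omega

/-- A simplex of codimension two in `T` lies in exactly two facets of `T`. -/
theorem card_facets_between [DecidableEq α] {e T : Finset α} (hT : T.card = n + 1)
    (he : e.card + 1 = n) (heT : e ⊆ T) :
    ((T.powersetCard n).filter (e ⊆ ·)).card = 2 := by
  have : (T.powersetCard n).filter (e ⊆ ·) = (T \ e).image (insert · e) := by
    ext F
    simp only [Finset.mem_filter, Finset.mem_powersetCard, Finset.mem_image, Finset.mem_sdiff]
    constructor
    · rintro ⟨⟨h1, h2⟩, h3⟩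
      obtain ⟨x, hx⟩ : ∃ x, F \ e = {x} := by
        rw [← Finset.card_eq_one, Finset.card_sdiff_of_subset h3]; omega
      have hxF : x ∈ F \ e := by rw [hx]; exact Finset.mem_singleton_self x
      rw [Finset.mem_sdiff] at hxF
      refine ⟨x, ⟨h1 hxF.1, hxF.2⟩, ?_⟩
      rw [Finset.insert_eq, ← hx, Finset.sdiff_union_of_subset h3]
    · rintro ⟨x, ⟨h1, h2⟩, rfl⟩
      exact ⟨⟨Finset.insert_subset h1 heT, by rw [Finset.card_insert_of_notMem h2, he]⟩,
        Finset.subset_insert _ _⟩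
  rw [this, Finset.card_image_of_injOn, Finset.card_sdiff_of_subset heT]
  · omega
  · intro x hx y hy hxy
    rw [Finset.mem_coe, Finset.mem_sdiff] at hx hy
    have : x ∈ insert y e := by
      rw [← show insert x e = insert y e from hxy]; exact Finset.mem_insert_self _ _
    exact (Finset.mem_insert.1 this).resolve_right hx.2

namespace IsPseudomanifold

theorem finite_bricks (h : K.IsPseudomanifold n) : (K.bricks n).Finite :=
  h.finite.subset fun _ hT => hT.1

theorem finite_facets (h : K.IsPseudomanifold n) : (K.facets n).Finite :=
  h.finite.subset fun _ hT => hT.1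

theorem finite_cutSet (h : K.IsPseudomanifold n) (X : Set (Finset α)) : (K.cutSet n X).Finite :=
  h.finite_facets.subset (cutSet_subset_facets X)

/-- The brick on the other side of a facet of `T`. -/
theorem exists_neighbor (h : K.IsPseudomanifold n) {F T : Finset α} (hF : F ∈ K.facets n)
    (hT : T ∈ K.bricks n) (hFT : F ⊆ T) :
    ∃ T' ∈ K.bricks n, T' ≠ T ∧ F ⊆ T' ∧ ∀ U ∈ K.bricks n, F ⊆ U → U = T ∨ U = T' := by
  obtain ⟨A, B, hAB, hset⟩ := Set.ncard_eq_two.1 (h.two_bricks F hF)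
  have hA : A ∈ {T | T ∈ K.bricks n ∧ F ⊆ T} := by rw [hset]; simp
  have hB : B ∈ {T | T ∈ K.bricks n ∧ F ⊆ T} := by rw [hset]; simp
  have hall : ∀ U ∈ K.bricks n, F ⊆ U → U = A ∨ U = B := fun U hU hFU => by
    have : U ∈ {T | T ∈ K.bricks n ∧ F ⊆ T} := ⟨hU, hFU⟩
    rw [hset] at this
    simpa using this
  rcases hall T hT hFT with rfl | rfl
  · exact ⟨B, hB.1, hAB.symm, hB.2, hall⟩
  · exact ⟨A, hA.1, hAB, hA.2, fun U hU hFU => (hall U hU hFU).symm⟩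

theorem ncard_facets_of_brick (hn : 1 ≤ n) {T : Finset α} (hT : T ∈ K.bricks n) :
    {F | F ∈ K.facets n ∧ F ⊆ T}.ncard = n + 1 := by
  have : {F | F ∈ K.facets n ∧ F ⊆ T} = ↑(T.powersetCard n) := by
    ext F
    rw [Set.mem_ofPred_eq, Finset.mem_coe, Finset.mem_powersetCard]
    constructor
    · rintro ⟨h1, h2⟩
      exact ⟨h2, h1.2⟩
    · rintro ⟨h1, h2⟩
      exact ⟨mem_facets_of_subset hn hT.1 h2 h1, h1⟩
  rw [this, Set.ncard_coe_finset, Finset.card_powersetCard, hT.2, Nat.choose_succ_self_right]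

/-- For a facet `F` of a brick `T` outside `X`: `F` is in the cut exactly if its other brick is
in `X`. -/
theorem mem_cutSet_iff_of_notMem {X : Set (Finset α)}
    {F T : Finset α} (hF : F ∈ K.facets n) (hT : T ∈ K.bricks n) (hFT : F ⊆ T) (hTX : T ∉ X) :
    F ∈ K.cutSet n X ↔ ∃ T' ∈ K.bricks n, T' ∈ X ∧ F ⊆ T' :=
  ⟨fun h => h.2.1, fun h => ⟨hF, h, T, hT, hTX, hFT⟩⟩

theorem mem_cutSet_insert_of_not_subset {X : Set (Finset α)} {F T : Finset α} (hFT : ¬ F ⊆ T) :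
    F ∈ K.cutSet n (insert T X) ↔ F ∈ K.cutSet n X := by
  have hne : ∀ U, F ⊆ U → U ≠ T := fun U hU e => hFT (e ▸ hU)
  refine and_congr Iff.rfl (and_congr (exists_congr fun U => ?_) (exists_congr fun U => ?_))
  · rw [Set.mem_insert_iff]
    have := hne U
    tauto
  · rw [Set.mem_insert_iff]
    have := hne U
    tauto

theorem mem_cutSet_insert_of_subset (h : K.IsPseudomanifold n) {X : Set (Finset α)}
    {F T : Finset α} (hF : F ∈ K.facets n) (hT : T ∈ K.bricks n) (hTX : T ∉ X) (hFT : F ⊆ T) :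
    F ∈ K.cutSet n (insert T X) ↔ F ∉ K.cutSet n X := by
  constructor
  · rintro ⟨-, -, U, hU, hUX, hFU⟩
    rintro ⟨-, ⟨V, hV, hVX, hFV⟩, -⟩
    obtain ⟨T', -, -, -, hall⟩ := h.exists_neighbor hF hT hFT
    rw [Set.mem_insert_iff, not_or] at hUX
    have hU' := (hall U hU hFU).resolve_left hUX.1
    have hV' := (hall V hV hFV).resolve_left fun e => hTX (e ▸ hVX)
    exact hUX.2 (hU' ▸ hV' ▸ hVX)
  · intro hc
    obtain ⟨T', hT', hne, hFT', -⟩ := h.exists_neighbor hF hT hFT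
    refine ⟨hF, ⟨T, hT, Set.mem_insert _ _, hFT⟩, T', hT', ?_, hFT'⟩
    rintro (e | e)
    · exact hne e
    · exact hc ((mem_cutSet_iff_of_notMem hF hT hFT hTX).2 ⟨T', hT', e, hFT'⟩)

theorem ncard_cutSet_add_ncard_sdiff (h : K.IsPseudomanifold n) (hn : 1 ≤ n)
    (X : Set (Finset α)) {T : Finset α} (hT : T ∈ K.bricks n) :
    {F | F ∈ K.cutSet n X ∧ F ⊆ T}.ncard +
      {F | (F ∈ K.facets n ∧ F ⊆ T) ∧ F ∉ K.cutSet n X}.ncard = n + 1 := by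
  rw [← ncard_facets_of_brick hn hT, ← Set.ncard_union_eq _
    (h.finite_facets.subset fun F hF => hF.1.1) (h.finite_facets.subset fun F hF => hF.1.1)]
  · congr 1
    ext F
    simp only [Set.mem_union, Set.mem_ofPred_eq]
    have : F ∈ K.cutSet n X → F ∈ K.facets n := fun h => h.1
    tauto
  · rw [Set.disjoint_left]
    rintro F ⟨h1, -⟩ ⟨-, h2⟩
    exact h2 h1

theorem ncard_cutSet_split (h : K.IsPseudomanifold n) (X : Set (Finset α)) (T : Finset α) :
    (K.cutSet n X).ncard =
      {F | F ∈ K.cutSet n X ∧ ¬ F ⊆ T}.ncard + {F | F ∈ K.cutSet n X ∧ F ⊆ T}.ncard := by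
  rw [← Set.ncard_union_eq _ ((h.finite_cutSet X).subset fun F hF => hF.1)
    ((h.finite_cutSet X).subset fun F hF => hF.1)]
  · congr 1
    ext F
    simp only [Set.mem_union, Set.mem_ofPred_eq]
    tauto
  · rw [Set.disjoint_left]
    rintro F ⟨-, h1⟩ ⟨-, h2⟩
    exact h1 h2

/-- Adding a brick `T` to `X` removes from the cut the facets of `T` in the cut, and adds the other
facets of `T`. -/
theorem cut_insert (h : K.IsPseudomanifold n) (hn : 1 ≤ n) {X : Set (Finset α)} {T : Finset α}
    (hT : T ∈ K.bricks n) (hTX : T ∉ X) :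
    K.cut n (insert T X) + 2 * {F | F ∈ K.cutSet n X ∧ F ⊆ T}.ncard = K.cut n X + (n + 1) := by
  have e1 := h.ncard_cutSet_split X T
  have e2 := h.ncard_cutSet_split (insert T X) T
  have e3 := h.ncard_cutSet_add_ncard_sdiff hn X hT
  have e4 : {F | F ∈ K.cutSet n (insert T X) ∧ ¬ F ⊆ T} =
      {F | F ∈ K.cutSet n X ∧ ¬ F ⊆ T} := by
    ext F
    exact and_congr_left fun hF => mem_cutSet_insert_of_not_subset hF
  have e5 : {F | F ∈ K.cutSet n (insert T X) ∧ F ⊆ T} =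
      {F | (F ∈ K.facets n ∧ F ⊆ T) ∧ F ∉ K.cutSet n X} := by
    ext F
    constructor
    · rintro ⟨h1, h2⟩
      exact ⟨⟨h1.1, h2⟩, (h.mem_cutSet_insert_of_subset h1.1 hT hTX h2).1 h1⟩
    · rintro ⟨⟨h1, h2⟩, h3⟩
      exact ⟨(h.mem_cutSet_insert_of_subset h1 hT hTX h2).2 h3, h2⟩
  rw [e4, e5] at e2
  unfold cut
  omega

/-- Bricks and facets around a simplex `e` of codimension two form cycles; hence a cut contains an
even number of facets around `e`. -/
theorem even_ncard_cutSet_link (h : K.IsPseudomanifold n) (X : Set (Finset α))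
    {e : Finset α} (he : e.card + 1 = n) : Even {F | F ∈ K.cutSet n X ∧ e ⊆ F}.ncard := by
  classical
  set 𝓑 : Finset (Finset α) := h.finite_bricks.toFinset.filter (· ∈ X)
  set 𝓕 : Finset (Finset α) := h.finite_facets.toFinset.filter (e ⊆ ·)
  have hdc : ∑ F ∈ 𝓕, (𝓑.filter (F ⊆ ·)).card = ∑ T ∈ 𝓑, (𝓕.filter (· ⊆ T)).card :=
    Finset.sum_card_bipartiteAbove_eq_sum_card_bipartiteBelow (s := 𝓕) (t := 𝓑)
      fun F T : Finset α => F ⊆ T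
  have heven : Even (∑ T ∈ 𝓑, (𝓕.filter (· ⊆ T)).card) := by
    refine Finset.even_sum _ fun T hT => ?_
    have hT' : T ∈ K.bricks n := by simpa using (Finset.mem_filter.1 hT).1
    by_cases heT : e ⊆ T
    · have : 𝓕.filter (· ⊆ T) = (T.powersetCard n).filter (e ⊆ ·) := by
        ext F
        simp only [𝓕, Finset.mem_filter, Set.Finite.mem_toFinset, Finset.mem_powersetCard]
        constructor
        · rintro ⟨⟨h1, h2⟩, h3⟩
          exact ⟨⟨h3, h1.2⟩, h2⟩
        · rintro ⟨⟨h1, h2⟩, h3⟩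
          exact ⟨⟨mem_facets_of_subset (by omega) hT'.1 h2 h1, h3⟩, h1⟩
      rw [this, card_facets_between hT'.2 he heT]
      exact even_two
    · have : 𝓕.filter (· ⊆ T) = ∅ := by
        rw [Finset.filter_eq_empty_iff]
        intro F hF hFT
        exact heT ((Finset.mem_filter.1 hF).2.trans hFT)
      rw [this]
      exact ⟨0, rfl⟩
  rw [← hdc, ← Nat.not_odd_iff_even, Finset.odd_sum_iff_odd_card_odd, Nat.not_odd_iff_even]
    at heven
  have hset : {F | F ∈ K.cutSet n X ∧ e ⊆ F} =
      ↑(𝓕.filter fun F => Odd (𝓑.filter (F ⊆ ·)).card) := by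
    ext F
    simp only [Set.mem_ofPred_eq, Finset.coe_filter, 𝓕, Finset.mem_filter,
      Set.Finite.mem_toFinset]
    by_cases hF : F ∈ K.facets n
    swap
    · simp only [hF, false_and, iff_false]
      exact fun h' => hF h'.1.1
    by_cases heF : e ⊆ F
    swap
    · simp only [heF, and_false, false_and]
    simp only [hF, heF, and_true, true_and]
    obtain ⟨A, B, hAB, hset⟩ := Set.ncard_eq_two.1 (h.two_bricks F hF)
    have hmem : ∀ U, U ∈ K.bricks n ∧ F ⊆ U ↔ U = A ∨ U = B := fun U => by
      have := Set.ext_iff.1 hset U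
      simpa using this
    have hcut : F ∈ K.cutSet n X ↔ (A ∈ X ∨ B ∈ X) ∧ (A ∉ X ∨ B ∉ X) := by
      have hA := (hmem A).2 (Or.inl rfl)
      have hB := (hmem B).2 (Or.inr rfl)
      constructor
      · rintro ⟨-, ⟨U, hU, hUX, hFU⟩, V, hV, hVX, hFV⟩
        rcases (hmem U).1 ⟨hU, hFU⟩ with rfl | rfl <;> rcases (hmem V).1 ⟨hV, hFV⟩ with rfl | rfl <;>
          tauto
      · rintro ⟨h1, h2⟩
        refine ⟨hF, ?_, ?_⟩
        · rcases h1 with h1 | h1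
          exacts [⟨A, hA.1, h1, hA.2⟩, ⟨B, hB.1, h1, hB.2⟩]
        · rcases h2 with h1 | h1
          exacts [⟨A, hA.1, h1, hA.2⟩, ⟨B, hB.1, h1, hB.2⟩]
    have hfil : 𝓑.filter (F ⊆ ·) = ({A, B} : Finset (Finset α)).filter (· ∈ X) := by
      ext U
      have := hmem U
      simp only [𝓑, Finset.mem_filter, Set.Finite.mem_toFinset, Finset.mem_insert,
        Finset.mem_singleton]
      tauto
    rw [hcut, hfil, Finset.filter_insert, Finset.filter_singleton]
    by_cases hA : A ∈ X <;> by_cases hB : B ∈ X <;> simp [hA, hB, hAB]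
  rw [hset, Set.ncard_coe_finset]
  exact heven

/-- In a strongly connected complex, a set of bricks with empty cut is empty or everything. -/
theorem cutSet_nonempty (h : K.IsPseudomanifold n) {X : Set (Finset α)} {T T' : Finset α}
    (hT : T ∈ K.bricks n) (hTX : T ∈ X) (hT' : T' ∈ K.bricks n) (hTX' : T' ∉ X) :
    (K.cutSet n X).Nonempty := by
  obtain ⟨p⟩ := h.stronglyConnected.preconnected ⟨T, hT⟩ ⟨T', hT'⟩
  obtain ⟨d, -, hd1, hd2⟩ := p.exists_boundary_dart {U | U.1 ∈ X} hTX hTX'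
  obtain ⟨-, F, hF, h1, h2⟩ := d.adj
  exact ⟨F, hF, ⟨_, d.fst.2, hd1, h1⟩, _, d.snd.2, hd2, h2⟩

end IsPseudomanifold

/-- A criterion for strong connectedness by cuts. -/
theorem connected_dualGraph_of_cutSet (hne : (K.bricks n).Nonempty)
    (h : ∀ X : Set (Finset α), ∀ T ∈ K.bricks n, ∀ T' ∈ K.bricks n, T ∈ X → T' ∉ X →
      (K.cutSet n X).Nonempty) : (K.dualGraph n).Connected := by
  have : Nonempty (K.bricks n) := hne.to_subtype
  refine ⟨fun T T' => ?_⟩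
  by_contra hcon
  obtain ⟨F, hF, ⟨U, hU, ⟨hU', hTU⟩, hFU⟩, V, hV, hVX, hFV⟩ :=
    h {U | ∃ hU : U ∈ K.bricks n, (K.dualGraph n).Reachable T ⟨U, hU⟩} T.1 T.2 T'.1 T'.2
      ⟨T.2, SimpleGraph.Reachable.refl _⟩ (fun ⟨_, h'⟩ => hcon h')
  refine hVX ⟨hV, ?_⟩
  by_cases hUV : U = V
  · subst hUV; exact hTU
  · exact hTU.trans (SimpleGraph.Adj.reachable (G := K.dualGraph n) (u := ⟨U, hU⟩) (v := ⟨V, hV⟩)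
      ⟨fun e => hUV (congrArg Subtype.val e), F, hF, hFU, hFV⟩)

end PreAbstractSimplicialComplex

namespace PreAbstractSimplicialComplex

universe u v

variable {α : Type u} {β : Type v} {K : PreAbstractSimplicialComplex α} {n : ℕ}

namespace IsPseudomanifold

/-- For facets `F`, `F'` of a brick `C`, the first in the cut and the second not, another
facet of the cut contains `F ∩ F'`, and it is not a facet of `C`. Distinct pairs give distinct
facets. -/
theorem ncard_mul_ncard_le_ncard_cutSet (h : K.IsPseudomanifold n) (X : Set (Finset α))
    {C : Finset α} (hC : C ∈ K.bricks n) :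
    {F | F ∈ K.cutSet n X ∧ F ⊆ C}.ncard *
      {F | (F ∈ K.facets n ∧ F ⊆ C) ∧ F ∉ K.cutSet n X}.ncard ≤
      {F | F ∈ K.cutSet n X ∧ ¬ F ⊆ C}.ncard := by
  classical
  have hex : ∀ p ∈ {F | F ∈ K.cutSet n X ∧ F ⊆ C} ×ˢ
      {F | (F ∈ K.facets n ∧ F ⊆ C) ∧ F ∉ K.cutSet n X},
      ∃ G, (G ∈ K.cutSet n X ∧ ¬ G ⊆ C) ∧ p.1 ∩ p.2 ⊆ G := by
    rintro ⟨F, F'⟩ ⟨⟨hF, hFC⟩, ⟨hF', hFC'⟩, hF'c⟩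
    dsimp only at *
    have hne : F ≠ F' := fun e => hF'c (e ▸ hF)
    have hev := h.even_ncard_cutSet_link X (card_inter_facets hC.2 hF.1.2 hF'.2 hFC hFC' hne)
    have hfin : {G | G ∈ K.cutSet n X ∧ F ∩ F' ⊆ G}.Finite :=
      (h.finite_cutSet X).subset fun G hG => hG.1
    have hmem : F ∈ {G | G ∈ K.cutSet n X ∧ F ∩ F' ⊆ G} := ⟨hF, Finset.inter_subset_left⟩
    have hpos := (Set.ncard_pos hfin).2 ⟨F, hmem⟩
    have hone : 1 < {G | G ∈ K.cutSet n X ∧ F ∩ F' ⊆ G}.ncard := by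
      obtain ⟨k, hk⟩ := hev
      omega
    obtain ⟨G, hG, hGF⟩ := Set.exists_ne_of_one_lt_ncard hone F
    refine ⟨G, ⟨hG.1, fun hGC => ?_⟩, hG.2⟩
    rcases eq_or_eq_of_inter_subset hC.2 hF.1.2 hF'.2 hG.1.1.2 hFC hFC' hGC hG.2 with e | e
    · exact hGF e
    · exact hF'c (e ▸ hG.1)
  choose! g hg using hex
  rw [← Set.ncard_prod]
  refine Set.ncard_le_ncard_of_injOn g (fun p hp => (hg p hp).1) ?_
    ((h.finite_cutSet X).subset fun G hG => hG.1)
  have key : ∀ p ∈ {F | F ∈ K.cutSet n X ∧ F ⊆ C} ×ˢ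
      {F | (F ∈ K.facets n ∧ F ⊆ C) ∧ F ∉ K.cutSet n X}, g p ∩ C = p.1 ∩ p.2 := by
    rintro ⟨F, F'⟩ hp
    obtain ⟨⟨hG, hGC⟩, hsub⟩ := hg _ hp
    obtain ⟨⟨hF, hFC⟩, ⟨hF', hFC'⟩, hF'c⟩ := hp
    dsimp only at *
    have hne : F ≠ F' := fun e => hF'c (e ▸ hF)
    have hc := card_inter_facets hC.2 hF.1.2 hF'.2 hFC hFC' hne
    refine (Finset.eq_of_subset_of_card_le (Finset.subset_inter hsub
      (Finset.inter_subset_left.trans hFC)) ?_).symm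
    have : (g (F, F') ∩ C).card < n := by
      rw [← hG.1.2]
      refine Finset.card_lt_card (Finset.ssubset_iff_subset_ne.2 ⟨Finset.inter_subset_left, ?_⟩)
      exact fun e => hGC (Finset.inter_eq_left.1 e)
    omega
  rintro ⟨F₁, F₁'⟩ hp ⟨F₂, F₂'⟩ hq hpq
  have e : F₁ ∩ F₁' = F₂ ∩ F₂' := by
    have h1 := key _ hp
    rw [hpq, key _ hq] at h1
    exact h1.symm
  obtain ⟨⟨hF, hFC⟩, ⟨hF', hFC'⟩, hF'c⟩ := hp
  obtain ⟨⟨hH, hHC⟩, ⟨hH', hHC'⟩, hH'c⟩ := hq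
  dsimp only at *
  have hne : F₁ ≠ F₁' := fun e => hF'c (e ▸ hF)
  have hFH : F₂ = F₁ := (eq_or_eq_of_inter_subset hC.2 hF.1.2 hF'.2 hH.1.2 hFC hFC' hHC
    (e ▸ Finset.inter_subset_left)).resolve_right fun e' => hF'c (e' ▸ hH)
  have hFH' : F₂' = F₁' := (eq_or_eq_of_inter_subset hC.2 hF.1.2 hF'.2 hH'.2 hFC hFC' hHC'
    (e ▸ Finset.inter_subset_right)).resolve_left fun e' => hH'c (e' ▸ hF)
  rw [hFH, hFH']

/-- A set of bricks that splits the bricks other than `C` cuts some facet off `C`: removing a brick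
leaves the complex strongly connected. -/
theorem ncard_cutSet_not_subset_pos (h : K.IsPseudomanifold n) (hn : 1 ≤ n) {X : Set (Finset α)}
    {C T T' : Finset α} (hC : C ∈ K.bricks n) (hCX : C ∉ X) (hT : T ∈ K.bricks n) (hTX : T ∈ X)
    (hT' : T' ∈ K.bricks n) (hTC' : T' ≠ C) (hTX' : T' ∉ X) :
    0 < {F | F ∈ K.cutSet n X ∧ ¬ F ⊆ C}.ncard := by
  have hsum := h.ncard_cutSet_add_ncard_sdiff hn X hC
  have hmul := h.ncard_mul_ncard_le_ncard_cutSet X hC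
  have hfin1 : {F | F ∈ K.cutSet n X ∧ F ⊆ C}.Finite :=
    h.finite_facets.subset fun F hF => hF.1.1
  have hfin2 : {F | (F ∈ K.facets n ∧ F ⊆ C) ∧ F ∉ K.cutSet n X}.Finite :=
    h.finite_facets.subset fun F hF => hF.1.1
  have hfin3 : {F | F ∈ K.cutSet n X ∧ ¬ F ⊆ C}.Finite :=
    h.finite_facets.subset fun F hF => hF.1.1
  rcases Set.eq_empty_or_nonempty {F | F ∈ K.cutSet n X ∧ F ⊆ C} with hI | hI
  · obtain ⟨F, hF⟩ := h.cutSet_nonempty hT hTX hT' hTX'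
    refine (Set.ncard_pos hfin3).2 ⟨F, hF, fun hFC => ?_⟩
    have : F ∈ {F | F ∈ K.cutSet n X ∧ F ⊆ C} := ⟨hF, hFC⟩
    rw [hI] at this
    exact this
  rcases Set.eq_empty_or_nonempty {F | (F ∈ K.facets n ∧ F ⊆ C) ∧ F ∉ K.cutSet n X} with hJ | hJ
  · obtain ⟨F, hF⟩ := h.cutSet_nonempty (X := insert C X) hT (Set.mem_insert_of_mem _ hTX) hT'
      (fun e => e.elim hTC' hTX')
    have hFC : ¬ F ⊆ C := fun hFC => by
      have : F ∈ {F | (F ∈ K.facets n ∧ F ⊆ C) ∧ F ∉ K.cutSet n X} :=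
        ⟨⟨hF.1, hFC⟩, (h.mem_cutSet_insert_of_subset hF.1 hC hCX hFC).1 hF⟩
      rw [hJ] at this
      exact this
    exact (Set.ncard_pos hfin3).2 ⟨F, (mem_cutSet_insert_of_not_subset hFC).1 hF, hFC⟩
  · exact (Nat.mul_pos ((Set.ncard_pos hfin1).2 hI) ((Set.ncard_pos hfin2).2 hJ)).trans_le hmul

/-- Whatever part of the bricks other than `C` is taken, more facets off `C` are cut than facets of
`C`, provided that `C` is put on the right side: inside as soon as it has two neighbors there. With `k`
neighbors inside, at least `k * (n + 1 - k)` facets off `C` are cut, and either `k` or `n + 1 - k`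
facets of `C`. -/
theorem ncard_cutSet_subset_lt (h : K.IsPseudomanifold n) (hn : 2 ≤ n) {X : Set (Finset α)}
    {C T T' : Finset α} (hC : C ∈ K.bricks n) (hCX : C ∉ X) (hT : T ∈ K.bricks n) (hTX : T ∈ X)
    (hT' : T' ∈ K.bricks n) (hTC' : T' ≠ C) (hTX' : T' ∉ X) {Y : Set (Finset α)}
    (hY : Y = if 2 ≤ {F | F ∈ K.cutSet n X ∧ F ⊆ C}.ncard then insert C X else X) :
    {F | F ∈ K.cutSet n Y ∧ F ⊆ C}.ncard < {F | F ∈ K.cutSet n Y ∧ ¬ F ⊆ C}.ncard := by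
  have hsum := h.ncard_cutSet_add_ncard_sdiff (by omega) X hC
  have hmul := h.ncard_mul_ncard_le_ncard_cutSet X hC
  have hpos := h.ncard_cutSet_not_subset_pos (by omega) hC hCX hT hTX hT' hTC' hTX'
  split_ifs at hY with h2
  · subst hY
    have e4 : {F | F ∈ K.cutSet n (insert C X) ∧ ¬ F ⊆ C} =
        {F | F ∈ K.cutSet n X ∧ ¬ F ⊆ C} := by
      ext F
      exact and_congr_left fun hF => mem_cutSet_insert_of_not_subset hF
    have e5 : {F | F ∈ K.cutSet n (insert C X) ∧ F ⊆ C} =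
        {F | (F ∈ K.facets n ∧ F ⊆ C) ∧ F ∉ K.cutSet n X} := by
      ext F
      constructor
      · rintro ⟨h1, h2⟩
        exact ⟨⟨h1.1, h2⟩, (h.mem_cutSet_insert_of_subset h1.1 hC hCX h2).1 h1⟩
      · rintro ⟨⟨h1, h2⟩, h3⟩
        exact ⟨(h.mem_cutSet_insert_of_subset h1 hC hCX h2).2 h3, h2⟩
    rw [e4, e5]
    have := Nat.mul_le_mul_right {F | (F ∈ K.facets n ∧ F ⊆ C) ∧ F ∉ K.cutSet n X}.ncard h2
    omega
  · subst hY
    generalize {F | F ∈ K.cutSet n Y ∧ F ⊆ C}.ncard = a at *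
    interval_cases a
    · exact hpos
    · omega

end IsPseudomanifold

/-! ### Orderings and their levels -/

namespace Ordering

/-- The first `j` bricks. -/
def initial (O : K.Ordering n) (j : ℕ) : Set (Finset α) :=
  {T | ∃ hT : T ∈ K.bricks n, (O ⟨T, hT⟩ : ℕ) < j}

variable (O : K.Ordering n)

theorem mem_initial {T : Finset α} (hT : T ∈ K.bricks n) {j : ℕ} :
    T ∈ O.initial j ↔ (O ⟨T, hT⟩ : ℕ) < j :=
  ⟨fun ⟨_, h⟩ => h, fun h => ⟨hT, h⟩⟩

theorem level_eq_cut (j : ℕ) : O.level j = K.cut n (O.initial j) := by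
  unfold level cut
  congr 1
  ext F
  refine and_congr Iff.rfl (and_congr ⟨?_, ?_⟩ ⟨?_, ?_⟩)
  · rintro ⟨T, h1, h2⟩
    exact ⟨T.1, T.2, ⟨T.2, h1⟩, h2⟩
  · rintro ⟨T, hT, h1, h2⟩
    exact ⟨⟨T, hT⟩, (O.mem_initial hT).1 h1, h2⟩
  · rintro ⟨T, h1, h2⟩
    exact ⟨T.1, T.2, fun h => h1.not_gt ((O.mem_initial T.2).1 h), h2⟩
  · rintro ⟨T, hT, h1, h2⟩
    exact ⟨⟨T, hT⟩, not_lt.1 fun h => h1 ((O.mem_initial hT).2 h), h2⟩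

theorem initial_succ {j : ℕ} (hj : j < Nat.card (K.bricks n)) :
    O.initial (j + 1) = insert (O.symm ⟨j, hj⟩).1 (O.initial j) := by
  ext T
  rw [Set.mem_insert_iff]
  constructor
  · rintro ⟨hT, h⟩
    rcases (Nat.lt_succ_iff_lt_or_eq.1 h) with h | h
    · exact Or.inr ⟨hT, h⟩
    · left
      have : O ⟨T, hT⟩ = ⟨j, hj⟩ := Fin.ext h
      rw [← this, Equiv.symm_apply_apply]
  · rintro (rfl | ⟨hT, h⟩)
    · exact ⟨(O.symm ⟨j, hj⟩).2, by rw [Equiv.apply_symm_apply]; exact Nat.lt_succ_self j⟩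
    · exact ⟨hT, by omega⟩

theorem symm_notMem_initial {j : ℕ} (hj : j < Nat.card (K.bricks n)) :
    (O.symm ⟨j, hj⟩).1 ∉ O.initial j := by
  rintro ⟨_, h⟩
  rw [Equiv.apply_symm_apply] at h
  exact h.false

theorem initial_zero : O.initial 0 = ∅ := by
  ext T
  simp [initial]

theorem level_zero : O.level 0 = 0 := by
  rw [level_eq_cut, initial_zero, cut]
  simp [cutSet]

theorem level_eq_zero_of_le {j : ℕ} (hj : Nat.card (K.bricks n) ≤ j) : O.level j = 0 := by
  rw [level_eq_cut, cut]
  have : K.cutSet n (O.initial j) = ∅ := by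
    rw [Set.eq_empty_iff_forall_notMem]
    rintro F ⟨-, -, T, hT, h, -⟩
    exact h ⟨hT, (O ⟨T, hT⟩).2.trans_le hj⟩
  rw [this, Set.ncard_empty]

/-- Each brick has an odd number of facets when `n` is even, so that the level always changes. -/
theorem level_ne_level_succ (h : K.IsPseudomanifold n) (hn : 2 ≤ n) (heven : Even n) {j : ℕ}
    (hj : j < Nat.card (K.bricks n)) : O.level j ≠ O.level (j + 1) := by
  have := h.cut_insert (by omega) (O.symm ⟨j, hj⟩).2 (O.symm_notMem_initial hj)
  rw [← O.initial_succ hj, ← level_eq_cut, ← level_eq_cut] at this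
  obtain ⟨k, hk⟩ := heven
  omega

/-- In the absence of plateaus, the maxima are the strict local maxima. -/
theorem width_eq_sort_peaks (h : K.IsPseudomanifold n) (hn : 2 ≤ n) (heven : Even n) :
    O.width = (peaks O.level 0 (Nat.card (K.bricks n))).sort (· ≥ ·) := by
  classical
  have hne := fun j hj => O.level_ne_level_succ h hn heven (j := j) hj
  set N := Nat.card (K.bricks n) with hN
  have hN0 : 1 ≤ N := by
    have : Nonempty (K.bricks n) := h.nonempty.to_subtype
    have : Finite (K.bricks n) := h.finite_bricks.to_subtype
    exact Nat.card_pos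
  obtain ⟨M, hM⟩ : ∃ M, N = M + 1 := ⟨N - 1, by omega⟩
  have hmax : ∀ t, 1 ≤ t → t < N →
      (O.IsMaximum t ↔ O.level (t - 1) < O.level t ∧ O.level (t + 1) < O.level t) := by
    intro t ht htN
    constructor
    · rintro ⟨-, -, a, b, hat, htb, hbN, ha, hb, hc⟩
      have ha' : a = t - 1 := by
        by_contra hcon
        apply hne (t - 1) (by omega)
        rw [Nat.sub_add_cancel ht]
        exact (hc (t - 1) (by omega) (by omega)).symm
      have hb' : b = t + 1 := by
        by_contra hcon
        exact hne t (by omega) (hc (t + 1) (by omega) (by omega))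
      subst ha' hb'
      rw [Nat.sub_add_cancel ht] at ha
      exact ⟨ha, hb⟩
    · rintro ⟨h1, h2⟩
      refine ⟨ht, by omega, t - 1, t + 1, by omega, by omega, by omega, ?_, h2, ?_⟩
      · rwa [Nat.sub_add_cancel ht]
      · intro k h3 h4
        rw [show k = t by omega]
  unfold width
  congr 1
  have hlast : peaks O.level M (M + 1) = 0 := by
    apply peaks_succ_of_not
    rintro ⟨h1, -⟩
    rw [O.level_eq_zero_of_le (j := M + 1) (by omega)] at h1
    exact absurd h1 (Nat.not_lt_zero _)
  rw [← hN, hM, ← peaks_add_peaks _ (Nat.zero_le M) (by omega), hlast, add_zero]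
  have hmap : ∀ s : Finset ℕ, s.val.map O.level = ∑ t ∈ s, {O.level t} := by
    intro s
    rw [Finset.sum_eq_multiset_sum, ← Multiset.sum_map_singleton (s.val.map O.level),
      Multiset.map_map]
    rfl
  rw [hmap, Finset.sum_filter, peaks, Nat.add_sub_cancel,
    show Finset.Icc 1 M = (Finset.Ico 0 M).image (· + 1) by
      ext t
      simp only [Finset.mem_Icc, Finset.mem_image, Finset.mem_Ico]
      constructor
      · rintro ⟨h1, h2⟩
        exact ⟨t - 1, ⟨by omega, by omega⟩, by omega⟩
      · rintro ⟨s, ⟨h1, h2⟩, rfl⟩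
        omega,
    Finset.sum_image (fun a _ b _ hab => Nat.succ_injective hab)]
  refine Finset.sum_congr rfl fun t ht => ?_
  rw [Finset.mem_Ico] at ht
  have := hmax (t + 1) (by omega) (by omega)
  rw [Nat.add_sub_cancel] at this
  exact if_congr this rfl rfl

end Ordering

/-- A rank function, injective on the bricks, induces an ordering, in which the bricks of rank below
`t` come first. -/
theorem exists_ordering_of_rank (hfin : (K.bricks n).Finite) (r : K.bricks n → ℕ)
    (hr : Function.Injective r) [DecidablePred fun x => ∃ T, r T = x] :
    ∃ O : K.Ordering n, (∀ T t, (O T : ℕ) < Nat.count (fun x => ∃ T, r T = x) t ↔ r T < t) ∧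
      ∀ t, (∀ T, r T < t) → Nat.card (K.bricks n) = Nat.count (fun x => ∃ T, r T = x) t := by
  have : Finite (K.bricks n) := hfin.to_subtype
  have := Fintype.ofFinite (K.bricks n)
  have hR : (Set.ofPred fun x => ∃ T, r T = x).Finite := Set.finite_range r
  have hcard : hR.toFinset.card ≤ Nat.card (K.bricks n) := by
    rw [← Set.ncard_eq_toFinset_card _ hR]
    have := Set.ncard_image_le (f := r) (s := Set.univ) Set.finite_univ
    rw [Set.ncard_univ, Set.image_univ] at this
    exact this
  let O : K.bricks n → Fin (Nat.card (K.bricks n)) :=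
    fun T => ⟨_, (Nat.count_lt_card hR ⟨T, rfl⟩).trans_le hcard⟩
  have hO : Function.Injective O := fun T T' h =>
    hr (Nat.count_injective ⟨T, rfl⟩ ⟨T', rfl⟩ (congrArg Fin.val h))
  have hlt : ∀ T t, (O T : ℕ) < Nat.count (fun x => ∃ T, r T = x) t ↔ r T < t := fun T t =>
    ⟨Nat.lt_of_count_lt_count, Nat.count_strict_mono ⟨T, rfl⟩⟩
  have hbij : Function.Bijective O := (Fintype.bijective_iff_injective_and_card O).2
    ⟨hO, by rw [Fintype.card_fin, Nat.card_eq_fintype_card]⟩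
  refine ⟨Equiv.ofBijective O hbij, hlt, fun t ht => le_antisymm ?_
    ((Nat.count_le_card hR t).trans hcard)⟩
  by_contra hcon
  rw [not_le] at hcon
  obtain ⟨T, hT⟩ := hbij.2 ⟨_, hcon⟩
  have := (hlt T t).2 (ht T)
  rw [hT] at this
  exact this.false

namespace IsPseudomanifold

theorem width_le (h : K.IsPseudomanifold n) (O : K.Ordering n) : h.width ≤ O.width := by
  let := Fintype.ofFinite (K.Ordering n)
  exact Finset.inf'_le _ (Finset.mem_univ O)

theorem exists_width_eq (h : K.IsPseudomanifold n) : ∃ O : K.Ordering n, h.width = O.width := by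
  let := Fintype.ofFinite (K.Ordering n)
  obtain ⟨O, -, hO⟩ := Finset.exists_mem_eq_inf'
    (Finset.univ_nonempty_iff.2 h.nonempty_ordering) fun O : K.Ordering n => O.width
  exact ⟨O, hO⟩

end IsPseudomanifold

end PreAbstractSimplicialComplex

/-! ### Two pseudomanifolds glued along a common brick -/

namespace PreAbstractSimplicialComplex

universe u

variable {α : Type u}

/-- The union of `K₁` and `K₂` without the simplex `C`. This is the connected sum along `C` when the
common simplices of `K₁` and `K₂` are the faces of `C`. -/
def glue (K₁ K₂ : PreAbstractSimplicialComplex α) (C : Finset α) : PreAbstractSimplicialComplex α :=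
  K₁.remove C ⊔ K₂.remove C

/-- Two pseudomanifolds on the same vertex type that have exactly a brick `C` and its faces in
common. -/
structure MeetAlong (K₁ K₂ : PreAbstractSimplicialComplex α) (n : ℕ) (C : Finset α) : Prop where
  left : K₁.IsPseudomanifold n
  right : K₂.IsPseudomanifold n
  mem_left : C ∈ K₁.bricks n
  mem_right : C ∈ K₂.bricks n
  subset : ∀ s ∈ K₁, s ∈ K₂ → s ⊆ C

variable {K K₁ K₂ : PreAbstractSimplicialComplex α} {n : ℕ} {C : Finset α}

theorem glue_comm : glue K₁ K₂ C = glue K₂ K₁ C := sup_comm _ _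

theorem mem_glue {s : Finset α} : s ∈ glue K₁ K₂ C ↔ (s ∈ K₁ ∨ s ∈ K₂) ∧ ¬ C ⊆ s := by
  change (s ∈ K₁ ∧ ¬ C ⊆ s) ∨ (s ∈ K₂ ∧ ¬ C ⊆ s) ↔ _
  tauto

theorem mem_facets_glue (hC : C.card = n + 1) {F : Finset α} :
    F ∈ (glue K₁ K₂ C).facets n ↔ F ∈ K₁.facets n ∨ F ∈ K₂.facets n := by
  have : F.card = n → ¬ C ⊆ F := fun h h' => by
    have := Finset.card_le_card h'
    omega
  simp only [facets, Set.mem_ofPred_eq, mem_glue]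
  tauto

theorem mem_bricks_glue (hC : C.card = n + 1) {T : Finset α} :
    T ∈ (glue K₁ K₂ C).bricks n ↔ (T ∈ K₁.bricks n ∨ T ∈ K₂.bricks n) ∧ T ≠ C := by
  have : T.card = n + 1 → (C ⊆ T ↔ T = C) := fun h =>
    ⟨fun h' => (Finset.eq_of_subset_of_card_le h' (by omega)).symm, fun h' => h' ▸ subset_rfl⟩
  simp only [bricks, Set.mem_ofPred_eq, mem_glue]
  tauto

/-- A facet lies in the cut if exactly one of its two bricks lies in `X`. -/
theorem mem_cutSet_iff {X : Set (Finset α)} {F T T' : Finset α} (hF : F ∈ K.facets n)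
    (hT : T ∈ K.bricks n) (hT' : T' ∈ K.bricks n) (hFT : F ⊆ T) (hFT' : F ⊆ T')
    (hall : ∀ U ∈ K.bricks n, F ⊆ U → U = T ∨ U = T') :
    F ∈ K.cutSet n X ↔ ¬ (T ∈ X ↔ T' ∈ X) := by
  constructor
  · rintro ⟨-, ⟨U, hU, hUX, hFU⟩, V, hV, hVX, hFV⟩
    rcases hall U hU hFU with rfl | rfl <;> rcases hall V hV hFV with rfl | rfl <;> tauto
  · intro h
    by_cases hTX : T ∈ X
    · exact ⟨hF, ⟨T, hT, hTX, hFT⟩, T', hT', by tauto, hFT'⟩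
    · exact ⟨hF, ⟨T', hT', by tauto, hFT'⟩, T, hT, hTX, hFT⟩

theorem cutSet_eq_empty_of_forall_mem {X : Set (Finset α)} (h : ∀ T ∈ K.bricks n, T ∈ X) :
    K.cutSet n X = ∅ := by
  rw [Set.eq_empty_iff_forall_notMem]
  rintro F ⟨-, -, T, hT, hTX, -⟩
  exact hTX (h T hT)

theorem cutSet_eq_empty_of_forall_notMem {X : Set (Finset α)} (h : ∀ T ∈ K.bricks n, T ∉ X) :
    K.cutSet n X = ∅ := by
  rw [Set.eq_empty_iff_forall_notMem]
  rintro F ⟨-, ⟨T, hT, hTX, -⟩, -⟩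
  exact h T hT hTX

theorem cutSet_empty : K.cutSet n ∅ = ∅ :=
  cutSet_eq_empty_of_forall_notMem fun T _ => Set.notMem_empty T

namespace MeetAlong

theorem symm (h : MeetAlong K₁ K₂ n C) : MeetAlong K₂ K₁ n C :=
  ⟨h.right, h.left, h.mem_right, h.mem_left, fun s h₁ h₂ => h.subset s h₂ h₁⟩

theorem eq_of_mem (h : MeetAlong K₁ K₂ n C) {T : Finset α} (h₁ : T ∈ K₁.bricks n)
    (h₂ : T ∈ K₂.bricks n) : T = C :=
  Finset.eq_of_subset_of_card_le (h.subset T h₁.1 h₂.1) (by rw [h₁.2, h.mem_left.2])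

/-- The bricks around a facet of `C`: besides `C`, one on each side. -/
theorem exists_neighbors (h : MeetAlong K₁ K₂ n C) {F : Finset α} (hF₁ : F ∈ K₁.facets n)
    (hF₂ : F ∈ K₂.facets n) :
    ∃ T₁ ∈ K₁.bricks n, ∃ T₂ ∈ K₂.bricks n, T₁ ≠ C ∧ T₂ ≠ C ∧ T₁ ≠ T₂ ∧ F ⊆ T₁ ∧ F ⊆ T₂ ∧
      (∀ U ∈ K₁.bricks n, F ⊆ U → U = C ∨ U = T₁) ∧
      (∀ U ∈ K₂.bricks n, F ⊆ U → U = C ∨ U = T₂) ∧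
      ∀ U ∈ (glue K₁ K₂ C).bricks n, F ⊆ U → U = T₁ ∨ U = T₂ := by
  have hFC := h.subset F hF₁.1 hF₂.1
  obtain ⟨T₁, hT₁, hne₁, hFT₁, hall₁⟩ := h.left.exists_neighbor hF₁ h.mem_left hFC
  obtain ⟨T₂, hT₂, hne₂, hFT₂, hall₂⟩ := h.right.exists_neighbor hF₂ h.mem_right hFC
  refine ⟨T₁, hT₁, T₂, hT₂, hne₁, hne₂, ?_, hFT₁, hFT₂, hall₁, hall₂, ?_⟩
  · rintro rfl
    exact hne₁ (h.eq_of_mem hT₁ hT₂)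
  · intro U hU hFU
    rw [mem_bricks_glue h.mem_left.2] at hU
    rcases hU with ⟨hU | hU, hUC⟩
    · exact Or.inl ((hall₁ U hU hFU).resolve_left hUC)
    · exact Or.inr ((hall₂ U hU hFU).resolve_left hUC)

theorem mem_bricks_glue_iff_of_not_subset (h : MeetAlong K₁ K₂ n C) (hn : 1 ≤ n) {F : Finset α}
    (hF : F ∈ K₁.facets n) (hFC : ¬ F ⊆ C) {U : Finset α} (hFU : F ⊆ U) :
    U ∈ (glue K₁ K₂ C).bricks n ↔ U ∈ K₁.bricks n := by
  rw [mem_bricks_glue h.mem_left.2]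
  constructor
  · rintro ⟨hU | hU, -⟩
    · exact hU
    · exact absurd (h.subset F hF.1 (mem_facets_of_subset hn hU.1 hF.2 hFU).1) hFC
  · intro hU
    exact ⟨Or.inl hU, fun e => hFC (e ▸ hFU)⟩

theorem mem_cutSet_glue_iff_of_not_subset (h : MeetAlong K₁ K₂ n C) (hn : 1 ≤ n)
    {X : Set (Finset α)} {F : Finset α} (hF : F ∈ K₁.facets n) (hFC : ¬ F ⊆ C) :
    F ∈ (glue K₁ K₂ C).cutSet n X ↔ F ∈ K₁.cutSet n X := by
  have hb := fun U => h.mem_bricks_glue_iff_of_not_subset hn hF hFC (U := U)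
  refine and_congr ?_ (and_congr (exists_congr fun U => ?_) (exists_congr fun U => ?_))
  · rw [mem_facets_glue h.mem_left.2]
    exact ⟨fun _ => hF, fun _ => Or.inl hF⟩
  · have := hb U
    tauto
  · have := hb U
    tauto

/-- The cut of `X` in the connected sum: a facet of `C` separates its two bricks there if it
separates exactly one of them from `C`. -/
theorem cutSet_glue (h : MeetAlong K₁ K₂ n C) (hn : 1 ≤ n) (X : Set (Finset α)) :
    (glue K₁ K₂ C).cutSet n X = symmDiff (K₁.cutSet n X) (K₂.cutSet n X) := by
  ext F
  rw [Set.mem_symmDiff]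
  by_cases hF₁ : F ∈ K₁.facets n <;> by_cases hF₂ : F ∈ K₂.facets n
  · have hFC := h.subset F hF₁.1 hF₂.1
    obtain ⟨T₁, hT₁, T₂, hT₂, hne₁, hne₂, -, hFT₁, hFT₂, hall₁, hall₂, hall⟩ :=
      h.exists_neighbors hF₁ hF₂
    rw [mem_cutSet_iff hF₁ h.mem_left hT₁ hFC hFT₁ hall₁,
      mem_cutSet_iff hF₂ h.mem_right hT₂ hFC hFT₂ hall₂,
      mem_cutSet_iff ((mem_facets_glue h.mem_left.2).2 (Or.inl hF₁))
        ((mem_bricks_glue h.mem_left.2).2 ⟨Or.inl hT₁, hne₁⟩)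
        ((mem_bricks_glue h.mem_left.2).2 ⟨Or.inr hT₂, hne₂⟩) hFT₁ hFT₂ hall]
    tauto
  · have hFC : ¬ F ⊆ C := fun hFC => hF₂ (mem_facets_of_subset hn h.mem_right.1 hF₁.2 hFC)
    rw [h.mem_cutSet_glue_iff_of_not_subset hn hF₁ hFC]
    have : F ∉ K₂.cutSet n X := fun h' => hF₂ h'.1
    tauto
  · have hFC : ¬ F ⊆ C := fun hFC => hF₁ (mem_facets_of_subset hn h.mem_left.1 hF₂.2 hFC)
    rw [glue_comm, h.symm.mem_cutSet_glue_iff_of_not_subset hn hF₂ hFC]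
    have : F ∉ K₁.cutSet n X := fun h' => hF₁ h'.1
    tauto
  · have h1 : F ∉ K₁.cutSet n X := fun h' => hF₁ h'.1
    have h2 : F ∉ K₂.cutSet n X := fun h' => hF₂ h'.1
    have h3 : F ∉ (glue K₁ K₂ C).cutSet n X := fun h' =>
      ((mem_facets_glue h.mem_left.2).1 h'.1).elim hF₁ hF₂
    tauto

theorem exists_brick_glue (h : MeetAlong K₁ K₂ n C) (hn : 1 ≤ n) {s : Finset α} (hs : s ∈ K₁)
    (hCs : ¬ C ⊆ s) : ∃ T ∈ (glue K₁ K₂ C).bricks n, s ⊆ T := by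
  obtain ⟨T, hT, hsT⟩ := h.left.exists_brick s hs
  by_cases hTC : T = C
  · subst hTC
    obtain ⟨x, hxT, hxs⟩ := Finset.not_subset.1 hCs
    classical
    have hF : T.erase x ∈ K₁.facets n := mem_facets_of_subset hn hT.1
      (by rw [Finset.card_erase_of_mem hxT, hT.2, Nat.add_sub_cancel]) (Finset.erase_subset _ _)
    obtain ⟨T', hT', hne, hFT', -⟩ := h.left.exists_neighbor hF hT (Finset.erase_subset _ _)
    refine ⟨T', (mem_bricks_glue h.mem_left.2).2 ⟨Or.inl hT', hne⟩, subset_trans ?_ hFT'⟩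
    exact Finset.subset_erase.2 ⟨hsT, hxs⟩
  · exact ⟨T, (mem_bricks_glue h.mem_left.2).2 ⟨Or.inl hT, hTC⟩, hsT⟩

theorem exists_facet (h : MeetAlong K₁ K₂ n C) (hn : 1 ≤ n) :
    ∃ F, F ∈ K₁.facets n ∧ F ∈ K₂.facets n := by
  obtain ⟨F, hFC, hF⟩ := Finset.exists_subset_card_eq (s := C) (n := n) (by rw [h.mem_left.2]; omega)
  exact ⟨F, mem_facets_of_subset hn h.mem_left.1 hF hFC,
    mem_facets_of_subset hn h.mem_right.1 hF hFC⟩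

theorem ncard_bricks_glue (h : MeetAlong K₁ K₂ n C) (hn : 1 ≤ n) {F : Finset α}
    (hF : F ∈ K₁.facets n) : {T | T ∈ (glue K₁ K₂ C).bricks n ∧ F ⊆ T}.ncard = 2 := by
  by_cases hFC : F ⊆ C
  · obtain ⟨T₁, hT₁, T₂, hT₂, hne₁, hne₂, hne, hFT₁, hFT₂, -, -, hall⟩ :=
      h.exists_neighbors hF (mem_facets_of_subset hn h.mem_right.1 hF.2 hFC)
    refine Set.ncard_eq_two.2 ⟨T₁, T₂, hne, Set.ext fun U => ⟨fun hU => hall U hU.1 hU.2, ?_⟩⟩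
    rintro (rfl | rfl)
    · exact ⟨(mem_bricks_glue h.mem_left.2).2 ⟨Or.inl hT₁, hne₁⟩, hFT₁⟩
    · exact ⟨(mem_bricks_glue h.mem_left.2).2 ⟨Or.inr hT₂, hne₂⟩, hFT₂⟩
  · rw [← h.left.two_bricks F hF]
    congr 1
    ext U
    exact and_congr_left fun hFU => h.mem_bricks_glue_iff_of_not_subset hn hF hFC hFU

/-- Removing the brick `C` from `K₂` does not disconnect it: a set with empty cut in the connected sum
contains either all bricks of `K₂` other than `C` or none. -/
theorem mem_iff_mem_of_cutSet_glue (h : MeetAlong K₁ K₂ n C) (hn : 1 ≤ n) {X : Set (Finset α)}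
    (hX : (glue K₁ K₂ C).cutSet n X = ∅) {T T' : Finset α} (hT : T ∈ K₂.bricks n) (hTC : T ≠ C)
    (hT' : T' ∈ K₂.bricks n) (hTC' : T' ≠ C) (hTX : T ∈ X) : T' ∈ X := by
  by_contra hTX'
  have hpos := h.right.ncard_cutSet_not_subset_pos (X := X \ {C}) hn h.mem_right (fun e => e.2 rfl)
    hT ⟨hTX, hTC⟩ hT' hTC' fun e => hTX' e.1
  obtain ⟨F, hF, hFC⟩ := (Set.ncard_pos
    (h.right.finite_facets.subset fun F hF => hF.1.1)).1 hpos
  have hF' := (h.symm.mem_cutSet_glue_iff_of_not_subset hn hF.1 hFC).2 hF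
  rw [glue_comm, cutSet_congr (Y := X), hX] at hF'
  · exact hF'
  · intro U hU
    have := ((mem_bricks_glue h.mem_left.2).1 hU).2
    simp [this]

theorem isPseudomanifold_glue (h : MeetAlong K₁ K₂ n C) (hn : 1 ≤ n) :
    (glue K₁ K₂ C).IsPseudomanifold n := by
  obtain ⟨F, hF₁, hF₂⟩ := h.exists_facet hn
  obtain ⟨T₁, hT₁, T₂, hT₂, hne₁, hne₂, -, hFT₁, hFT₂, -, -, hall⟩ := h.exists_neighbors hF₁ hF₂
  have hb₁ := (mem_bricks_glue (K₂ := K₂) h.mem_left.2).2 ⟨Or.inl hT₁, hne₁⟩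
  have hb₂ := (mem_bricks_glue (K₁ := K₁) h.mem_left.2).2 ⟨Or.inr hT₂, hne₂⟩
  refine ⟨(h.left.finite.union h.right.finite).subset fun s hs => (mem_glue.1 hs).1, ⟨T₁, hb₁⟩,
    fun s hs => ?_, fun G hG => ?_, connected_dualGraph_of_cutSet ⟨T₁, hb₁⟩ ?_⟩
  · rcases mem_glue.1 hs with ⟨hs | hs, hCs⟩
    · exact h.exists_brick_glue hn hs hCs
    · rw [glue_comm]
      exact h.symm.exists_brick_glue hn hs hCs
  · rcases (mem_facets_glue h.mem_left.2).1 hG with hG | hG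
    · exact h.ncard_bricks_glue hn hG
    · rw [glue_comm]
      exact h.symm.ncard_bricks_glue hn hG
  · intro X T hT T' hT' hTX hTX'
    by_contra hcon
    rw [Set.not_nonempty_iff_eq_empty] at hcon
    have hcon' := hcon
    rw [glue_comm] at hcon'
    have hF : F ∉ (glue K₁ K₂ C).cutSet n X := by rw [hcon]; exact Set.notMem_empty F
    rw [mem_cutSet_iff ((mem_facets_glue h.mem_left.2).2 (Or.inl hF₁)) hb₁ hb₂ hFT₁ hFT₂ hall,
      not_not] at hF
    rw [mem_bricks_glue h.mem_left.2] at hT hT'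
    have hT₁X : T₁ ∈ X := by
      rcases hT with ⟨hT | hT, hTC⟩
      · exact h.symm.mem_iff_mem_of_cutSet_glue hn hcon' hT hTC hT₁ hne₁ hTX
      · exact hF.2 (h.mem_iff_mem_of_cutSet_glue hn hcon hT hTC hT₂ hne₂ hTX)
    rcases hT' with ⟨hT' | hT', hTC'⟩
    · exact hTX' (h.symm.mem_iff_mem_of_cutSet_glue hn hcon' hT₁ hne₁ hT' hTC' hT₁X)
    · exact hTX' (h.mem_iff_mem_of_cutSet_glue hn hcon hT₂ hne₂ hT' hTC' (hF.1 hT₁X))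

/-- If more facets off `C` than facets of `C` are cut in `K₂`, then the cut in the connected sum is
larger than the one in `K₁`. -/
theorem cut_lt_cut_glue (h : MeetAlong K₁ K₂ n C) (hn : 1 ≤ n) {X : Set (Finset α)}
    (hlt : {F | F ∈ K₂.cutSet n X ∧ F ⊆ C}.ncard < {F | F ∈ K₂.cutSet n X ∧ ¬ F ⊆ C}.ncard) :
    K₁.cut n X < (glue K₁ K₂ C).cut n X := by
  have hfin₁ := h.left.finite_cutSet X
  have hfin₂ := h.right.finite_cutSet X
  have hfin := (h.isPseudomanifold_glue hn).finite_cutSet X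
  have hfa : {F | F ∈ K₂.cutSet n X ∧ F ⊆ C}.Finite := hfin₂.subset fun F hF => hF.1
  have hfb : {F | F ∈ K₂.cutSet n X ∧ ¬ F ⊆ C}.Finite := hfin₂.subset fun F hF => hF.1
  have hout : ∀ F, F ∈ K₂.cutSet n X → ¬ F ⊆ C → F ∉ K₁.cutSet n X := fun F hF hFC hF' =>
    hFC (h.subset F hF'.1.1 hF.1.1)
  have hle : (K₁.cutSet n X ∪ {F | F ∈ K₂.cutSet n X ∧ ¬ F ⊆ C}).ncard ≤
      ((glue K₁ K₂ C).cutSet n X ∪ {F | F ∈ K₂.cutSet n X ∧ F ⊆ C}).ncard := by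
    refine Set.ncard_le_ncard ?_ (hfin.union hfa)
    rw [h.cutSet_glue hn]
    intro F hF
    simp only [Set.mem_union, Set.mem_symmDiff, Set.mem_ofPred_eq] at hF ⊢
    have := hout F
    tauto
  rw [Set.ncard_union_eq (Set.disjoint_left.2 fun F hF hF' => hout F hF'.1 hF'.2 hF) hfin₁ hfb]
    at hle
  have := Set.ncard_union_le ((glue K₁ K₂ C).cutSet n X) {F | F ∈ K₂.cutSet n X ∧ F ⊆ C}
  unfold cut
  omega

/-- The first brick of `K₂` to enter `X` raises the level: at most one of its facets, the one it may
share with `C`, is a facet of a brick of `K₁`. -/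
theorem cut_lt_cut_insert (h : MeetAlong K₁ K₂ n C) (hn : 2 ≤ n) {X : Set (Finset α)}
    {T : Finset α} (hT : T ∈ K₂.bricks n) (hTC : T ≠ C)
    (hX : ∀ U ∈ K₂.bricks n, U ≠ C → U ∉ X) :
    (glue K₁ K₂ C).cut n X < (glue K₁ K₂ C).cut n (insert T X) := by
  have hstep := (h.isPseudomanifold_glue (by omega)).cut_insert (by omega)
    ((mem_bricks_glue (K₁ := K₁) h.mem_left.2).2 ⟨Or.inr hT, hTC⟩) (hX T hT hTC)
  have hfin : {F | F ∈ (glue K₁ K₂ C).cutSet n X ∧ F ⊆ T}.Finite :=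
    ((h.isPseudomanifold_glue (by omega)).finite_cutSet X).subset fun F hF => hF.1
  have hle : {F | F ∈ (glue K₁ K₂ C).cutSet n X ∧ F ⊆ T}.ncard ≤ 1 := by
    have hsub : ∀ F, F ∈ (glue K₁ K₂ C).cutSet n X → F ⊆ T → F ⊆ C := by
      rintro F ⟨hF, ⟨U, hU, hUX, hFU⟩, -⟩ hFT
      rw [mem_bricks_glue h.mem_left.2] at hU
      have hU₁ : U ∈ K₁.bricks n := hU.1.resolve_right fun hU₂ => hX U hU₂ hU.2 hUX
      exact h.subset F (mem_facets_of_subset (by omega) hU₁.1 hF.2 hFU).1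
        (mem_facets_of_subset (by omega) hT.1 hF.2 hFT).1
    refine (Set.ncard_le_one hfin).2 ?_
    rintro F ⟨hF, hFT⟩ F' ⟨hF', hFT'⟩
    by_contra hne
    exact hTC (eq_of_common_facets hT.2 h.mem_right.2 hF.1.2 hF'.1.2 hne hFT hFT'
      (hsub F hF hFT) (hsub F' hF' hFT'))
  omega

/-- The last brick of `K₂` to enter lowers the level, by complementation. -/
theorem cut_insert_lt_cut (h : MeetAlong K₁ K₂ n C) (hn : 2 ≤ n) {X : Set (Finset α)}
    {T : Finset α} (hT : T ∈ K₂.bricks n) (hTC : T ≠ C) (hTX : T ∉ X)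
    (hX : ∀ U ∈ K₂.bricks n, U ≠ C → U ≠ T → U ∈ X) :
    (glue K₁ K₂ C).cut n (insert T X) < (glue K₁ K₂ C).cut n X := by
  have := h.cut_lt_cut_insert hn (X := (insert T X)ᶜ) hT hTC (by
    intro U hU hUC hUX
    rw [Set.mem_compl_iff, Set.mem_insert_iff, not_or] at hUX
    exact hUX.2 (hX U hU hUC hUX.1))
  have e : insert T (insert T X)ᶜ = Xᶜ := by
    ext U
    simp only [Set.mem_insert_iff, Set.mem_compl_iff, not_or]
    constructor
    · rintro (rfl | hU)
      exacts [hTX, hU.2]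
    · intro hU
      by_cases hUT : U = T
      exacts [Or.inl hUT, Or.inr ⟨hUT, hU⟩]
  rw [e] at this
  unfold cut at this ⊢
  rwa [cutSet_compl, cutSet_compl] at this

end MeetAlong

end PreAbstractSimplicialComplex

/-! ### Bounds on the width -/

namespace PreAbstractSimplicialComplex

universe u

variable {α : Type u} {K K₁ K₂ : PreAbstractSimplicialComplex α} {n : ℕ} {C : Finset α}

namespace Ordering

/-- The opposite ordering. -/
noncomputable def rev (O : K.Ordering n) : K.Ordering n := O.trans Fin.revPerm

theorem level_rev (O : K.Ordering n) {j : ℕ} (hj : j ≤ Nat.card (K.bricks n)) :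
    O.rev.level j = O.level (Nat.card (K.bricks n) - j) := by
  rw [level_eq_cut, level_eq_cut]
  unfold cut
  rw [← cutSet_compl]
  congr 1
  refine cutSet_congr fun T hT => ?_
  rw [Set.mem_compl_iff, mem_initial _ hT, mem_initial _ hT]
  have h1 : (O.rev ⟨T, hT⟩ : ℕ) = Nat.card (K.bricks n) - (O ⟨T, hT⟩ + 1) := Fin.val_rev _
  have h2 := (O ⟨T, hT⟩).2
  omega

theorem val_apply_symm (O : K.Ordering n) {j : ℕ} (hj : j < Nat.card (K.bricks n)) :
    (O (O.symm ⟨j, hj⟩) : ℕ) = j := by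
  rw [Equiv.apply_symm_apply]

/-- The second brick raises the level, as it shares at most one facet with the first. -/
theorem level_one_lt_level_two (O : K.Ordering n) (h : K.IsPseudomanifold n) (hn : 2 ≤ n) :
    3 ≤ Nat.card (K.bricks n) ∧ 0 < O.level 1 ∧ O.level 1 < O.level 2 := by
  have hN : 0 < Nat.card (K.bricks n) := by
    have : Nonempty (K.bricks n) := h.nonempty.to_subtype
    have : Finite (K.bricks n) := h.finite_bricks.to_subtype
    exact Nat.card_pos
  have h1 := h.cut_insert (by omega) (O.symm ⟨0, hN⟩).2 (O.symm_notMem_initial hN)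
  rw [← O.initial_succ hN, ← level_eq_cut, ← level_eq_cut, level_zero, initial_zero,
    cutSet_empty] at h1
  simp only [Set.mem_empty_iff_false, false_and, Set.ofPred_false, Set.ncard_empty] at h1
  have hN1 : 1 < Nat.card (K.bricks n) := by
    by_contra hcon
    rw [zero_add, O.level_eq_zero_of_le (not_lt.1 hcon)] at h1
    omega
  have h2 := h.cut_insert (by omega) (O.symm ⟨1, hN1⟩).2 (O.symm_notMem_initial hN1)
  rw [← O.initial_succ hN1, ← level_eq_cut, ← level_eq_cut] at h2
  have hle : {F | F ∈ K.cutSet n (O.initial 1) ∧ F ⊆ (O.symm ⟨1, hN1⟩).1}.ncard ≤ 1 := by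
    refine (Set.ncard_le_one ((h.finite_cutSet _).subset fun F hF => hF.1)).2 ?_
    have hsub : ∀ F, F ∈ K.cutSet n (O.initial 1) → F ⊆ (O.symm ⟨0, hN⟩).1 := by
      rintro F ⟨-, ⟨U, hU, hUX, hFU⟩, -⟩
      rw [← zero_add 1, O.initial_succ hN, O.initial_zero] at hUX
      rcases hUX with rfl | hUX
      exacts [hFU, absurd hUX (Set.notMem_empty U)]
    rintro F ⟨hF, hFT⟩ F' ⟨hF', hFT'⟩
    by_contra hne
    have := eq_of_common_facets (O.symm ⟨1, hN1⟩).2.2 (O.symm ⟨0, hN⟩).2.2 hF.1.2 hF'.1.2 hne hFT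
      hFT' (hsub F hF) (hsub F' hF')
    have := congrArg Fin.val (O.symm.injective (Subtype.ext this))
    exact one_ne_zero this
  rw [zero_add] at h1
  rw [one_add_one_eq_two] at h2
  have h3 : 3 ≤ Nat.card (K.bricks n) := by
    by_contra hcon
    rw [O.level_eq_zero_of_le (j := 2) (by omega)] at h2
    omega
  exact ⟨h3, by omega, by omega⟩

end Ordering

namespace MeetAlong

/-- The ordering of `K₁` induced by an ordering of the connected sum has smaller width. The brick `C`
takes the place of the second brick of `K₂` with a facet on `C`. Before the first and after the last
brick of `K₂` the levels agree, and in between they have strictly decreased. -/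
theorem exists_ordering_width_lt (h : MeetAlong K₁ K₂ n C) (hn : 2 ≤ n) (heven : Even n)
    (O : (glue K₁ K₂ C).Ordering n) : ∃ O₁ : K₁.Ordering n, O₁.width < O.width := by
  classical
  have hn1 : 1 ≤ n := by omega
  have hG := h.isPseudomanifold_glue hn1
  have hmemG : ∀ {T}, T ∈ (glue K₁ K₂ C).bricks n ↔
      (T ∈ K₁.bricks n ∨ T ∈ K₂.bricks n) ∧ T ≠ C := mem_bricks_glue h.mem_left.2
  have hCG : C ∉ (glue K₁ K₂ C).bricks n := fun hC => (hmemG.1 hC).2 rfl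
  have hCX : ∀ t, C ∉ O.initial t := fun t hC => hCG hC.1
  set N := Nat.card ((glue K₁ K₂ C).bricks n) with hN
  -- The position `t₀` of the second brick of `K₂` with a facet on `C`.
  have hkfin : ∀ t, {F | F ∈ K₂.cutSet n (O.initial t) ∧ F ⊆ C}.Finite := fun t =>
    (h.right.finite_cutSet _).subset fun F hF => hF.1
  have hkmono : ∀ s t, s ≤ t → {F | F ∈ K₂.cutSet n (O.initial s) ∧ F ⊆ C}.ncard ≤
      {F | F ∈ K₂.cutSet n (O.initial t) ∧ F ⊆ C}.ncard := by
    intro s t hst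
    refine Set.ncard_le_ncard ?_ (hkfin t)
    rintro F ⟨hF, hFC⟩
    refine ⟨?_, hFC⟩
    have hF' := hF.1
    rw [IsPseudomanifold.mem_cutSet_iff_of_notMem hF' h.mem_right hFC (hCX _)] at hF ⊢
    obtain ⟨T, hT, hTX, hFT⟩ := hF
    exact ⟨T, hT, ⟨hTX.1, hTX.2.trans_le hst⟩, hFT⟩
  have hkN : 2 ≤ {F | F ∈ K₂.cutSet n (O.initial N) ∧ F ⊆ C}.ncard := by
    have hsum := h.right.ncard_cutSet_add_ncard_sdiff hn1 (O.initial N) h.mem_right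
    have hempty : {F | (F ∈ K₂.facets n ∧ F ⊆ C) ∧ F ∉ K₂.cutSet n (O.initial N)} = ∅ := by
      rw [Set.eq_empty_iff_forall_notMem]
      rintro F ⟨⟨hF, hFC⟩, hFX⟩
      rw [IsPseudomanifold.mem_cutSet_iff_of_notMem hF h.mem_right hFC (hCX _)] at hFX
      obtain ⟨T, hT, hne, hFT, -⟩ := h.right.exists_neighbor hF h.mem_right hFC
      exact hFX ⟨T, hT, ⟨hmemG.2 ⟨Or.inr hT, hne⟩, (O _).2⟩, hFT⟩
    rw [hempty, Set.ncard_empty] at hsum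
    omega
  obtain ⟨t₀, ht₀N, ht₀⟩ : ∃ t₀ < N, ∀ t,
      2 ≤ {F | F ∈ K₂.cutSet n (O.initial t) ∧ F ⊆ C}.ncard ↔ t₀ < t := by
    have hex : ∃ t, 2 ≤ {F | F ∈ K₂.cutSet n (O.initial t) ∧ F ⊆ C}.ncard := ⟨N, hkN⟩
    have hle := Nat.find_min' hex hkN
    have hpos : Nat.find hex ≠ 0 := by
      intro h0
      have := Nat.find_spec hex
      rw [h0, O.initial_zero, cutSet_empty] at this
      simp at this
    refine ⟨Nat.find hex - 1, by omega, fun t => ⟨fun ht => ?_, fun ht => ?_⟩⟩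
    · have := Nat.find_min' hex ht
      omega
    · exact (Nat.find_spec hex).trans (hkmono _ _ (by omega))
  have hb₀ : (O.symm ⟨t₀, ht₀N⟩).1 ∈ K₂.bricks n := by
    by_contra hcon
    have h1 := (ht₀ (t₀ + 1)).2 (Nat.lt_succ_self _)
    have h2 := (not_congr (ht₀ t₀)).2 (lt_irrefl _)
    rw [O.initial_succ ht₀N, cutSet_congr (Y := O.initial t₀)] at h1
    · exact h2 h1
    · intro U hU
      rw [Set.mem_insert_iff, or_iff_right]
      rintro rfl
      exact hcon hU
  have hb₀C : (O.symm ⟨t₀, ht₀N⟩).1 ≠ C := (hmemG.1 (O.symm ⟨t₀, ht₀N⟩).2).2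
  -- The positions `t₁` and `t₂` of the first and the last brick of `K₂`.
  set B : Set ℕ := {t | ∃ ht : t < N, (O.symm ⟨t, ht⟩).1 ∈ K₂.bricks n} with hB
  have hBfin : B.Finite := (Set.finite_lt_nat N).subset fun t ht => ht.1
  obtain ⟨t₁, ⟨ht₁N, hb₁⟩, hmin⟩ := Set.exists_min_image B id hBfin ⟨t₀, ht₀N, hb₀⟩
  obtain ⟨t₂, ⟨ht₂N, hb₂⟩, hmax⟩ := Set.exists_max_image B id hBfin ⟨t₀, ht₀N, hb₀⟩
  have h10 : t₁ ≤ t₀ := hmin t₀ ⟨ht₀N, hb₀⟩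
  have h02 : t₀ ≤ t₂ := hmax t₀ ⟨ht₀N, hb₀⟩
  have hb₁C := (hmemG.1 (O.symm ⟨t₁, ht₁N⟩).2).2
  have hb₂C := (hmemG.1 (O.symm ⟨t₂, ht₂N⟩).2).2
  have hbefore : ∀ U ∈ K₂.bricks n, ∀ t ≤ t₁, U ∉ O.initial t := by
    rintro U hU t ht ⟨hUG, hlt⟩
    have := hmin (O ⟨U, hUG⟩) ⟨(O ⟨U, hUG⟩).2, by rwa [Fin.eta, Equiv.symm_apply_apply]⟩
    simp only [id] at this
    omega
  have hafter : ∀ U ∈ K₂.bricks n, U ≠ C → ∀ t, t₂ < t → U ∈ O.initial t := by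
    intro U hU hUC t ht
    have hUG := hmemG.2 ⟨Or.inr hU, hUC⟩
    have := hmax (O ⟨U, hUG⟩) ⟨(O ⟨U, hUG⟩).2, by rwa [Fin.eta, Equiv.symm_apply_apply]⟩
    exact ⟨hUG, lt_of_le_of_lt this ht⟩
  have hup : O.level t₁ < O.level (t₁ + 1) := by
    rw [O.level_eq_cut, O.level_eq_cut, O.initial_succ ht₁N]
    exact h.cut_lt_cut_insert hn hb₁ hb₁C fun U hU _ => hbefore U hU t₁ le_rfl
  have hdown : O.level (t₂ + 1) < O.level t₂ := by
    rw [O.level_eq_cut, O.level_eq_cut, O.initial_succ ht₂N]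
    refine h.cut_insert_lt_cut hn hb₂ hb₂C (O.symm_notMem_initial ht₂N) fun U hU hUC hne => ?_
    have := hafter U hU hUC (t₂ + 1) (Nat.lt_succ_self _)
    rw [O.initial_succ ht₂N] at this
    exact this.resolve_left hne
  have h12 : t₁ < t₂ := by
    refine lt_of_le_of_ne (h10.trans h02) fun e => ?_
    rw [e] at hup
    exact hup.not_gt hdown
  -- The induced ordering of `K₁`.
  have hA : ∀ T : K₁.bricks n, T.1 ≠ C → T.1 ∈ (glue K₁ K₂ C).bricks n := fun T hT =>
    hmemG.2 ⟨Or.inl T.2, hT⟩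
  set r : K₁.bricks n → ℕ := fun T => if hT : T.1 = C then t₀ else O ⟨T.1, hA T hT⟩ with hr
  have hrC : ∀ T : K₁.bricks n, T.1 = C → r T = t₀ := fun T hT => by simp [hr, hT]
  have hrA : ∀ T : K₁.bricks n, ∀ hT : T.1 ≠ C, r T = O ⟨T.1, hA T hT⟩ := fun T hT => by
    simp [hr, hT]
  have hrne : ∀ T : K₁.bricks n, T.1 ≠ C → r T ≠ t₀ := by
    intro T hT hrT
    rw [hrA T hT] at hrT
    have : O.symm ⟨t₀, ht₀N⟩ = ⟨T.1, hA T hT⟩ := by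
      rw [Equiv.symm_apply_eq]
      exact Fin.ext hrT.symm
    rw [this] at hb₀
    exact hT (h.eq_of_mem T.2 hb₀)
  have hrinj : Function.Injective r := by
    intro T T' hTT'
    by_cases hT : T.1 = C <;> by_cases hT' : T'.1 = C
    · exact Subtype.ext (hT.trans hT'.symm)
    · exact absurd (hTT'.symm.trans (hrC T hT)) (hrne T' hT')
    · exact absurd (hTT'.trans (hrC T' hT')) (hrne T hT)
    · rw [hrA T hT, hrA T' hT'] at hTT'
      exact Subtype.ext (Subtype.mk.inj (O.injective (Fin.ext hTT')))
  have hrN : ∀ T, r T < N := by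
    intro T
    by_cases hT : T.1 = C
    · rw [hrC T hT]; exact ht₀N
    · rw [hrA T hT]; exact (O _).2
  obtain ⟨O₁, hO₁, hcard⟩ := exists_ordering_of_rank h.left.finite_bricks r hrinj
  refine ⟨O₁, ?_⟩
  set m : ℕ → ℕ := Nat.count (fun x => ∃ T, r T = x) with hm
  have hN₁ : Nat.card (K₁.bricks n) = m N := hcard N hrN
  have hrange : ∀ x, (hx : x < N) → (O.symm ⟨x, hx⟩).1 ∉ K₂.bricks n → ∃ T, r T = x := by
    intro x hx hxK
    have hxG := hmemG.1 (O.symm ⟨x, hx⟩).2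
    refine ⟨⟨_, hxG.1.resolve_right hxK⟩, ?_⟩
    rw [hrA _ hxG.2]
    exact O.val_apply_symm hx
  have hlevel : ∀ t, O₁.level (m t) = K₁.cut n (if t₀ < t then insert C (O.initial t)
      else O.initial t) := by
    intro t
    rw [O₁.level_eq_cut]
    unfold cut
    congr 1
    refine cutSet_congr fun T hT => ?_
    rw [O₁.mem_initial hT, hO₁]
    by_cases hTC : T = C
    · rw [hrC ⟨T, hT⟩ hTC]
      subst hTC
      split_ifs with ht
      · exact ⟨fun _ => Set.mem_insert _ _, fun _ => ht⟩
      · exact ⟨fun h' => absurd h' ht, fun h' => absurd h' (hCX t)⟩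
    · rw [hrA ⟨T, hT⟩ hTC, ← O.mem_initial (hA ⟨T, hT⟩ hTC)]
      split_ifs
      · rw [Set.mem_insert_iff, or_iff_right hTC]
      · rfl
  have hcutG : ∀ t, O.level t = (glue K₁ K₂ C).cut n (if t₀ < t then insert C (O.initial t)
      else O.initial t) := by
    intro t
    rw [O.level_eq_cut]
    unfold cut
    congr 1
    refine cutSet_congr fun T hT => ?_
    split_ifs
    · rw [Set.mem_insert_iff, or_iff_right]
      rintro rfl
      exact hCG hT
    · rfl
  have hsame : ∀ t, K₂.cutSet n (if t₀ < t then insert C (O.initial t) else O.initial t) = ∅ →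
      O₁.level (m t) = O.level t := by
    intro t ht
    rw [hlevel, hcutG]
    unfold cut
    rw [h.cutSet_glue hn1, ht, ← Set.bot_eq_empty, symmDiff_bot]
  have hmleft : ∀ t ≤ t₁, m t = t := by
    intro t ht
    rw [hm, Nat.count_iff_forall]
    intro x hx
    refine hrange x (by omega) fun hxK => ?_
    have := hmin x ⟨by omega, hxK⟩
    simp only [id] at this
    omega
  have hmright : ∀ i, t₂ + 1 + i ≤ N → m (t₂ + 1 + i) = m (t₂ + 1) + i := by
    intro i hi
    rw [hm, Nat.count_add, Nat.add_left_cancel_iff, Nat.count_iff_forall]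
    intro x hx
    refine hrange _ (by omega) fun hxK => ?_
    have := hmax (t₂ + 1 + x) ⟨by omega, hxK⟩
    simp only [id] at this
    omega
  have hmN : m N = m (t₂ + 1) + (N - (t₂ + 1)) := by
    have := hmright (N - (t₂ + 1)) (by omega)
    rwa [show t₂ + 1 + (N - (t₂ + 1)) = N by omega] at this
  rw [O.width_eq_sort_peaks hG hn heven, O₁.width_eq_sort_peaks h.left hn heven]
  refine sort_peaks_lt_sort_peaks (t₁ := t₁) (t₂ := t₂) (s₂ := m (t₂ + 1)) h12 ht₂N ?_ ?_
    (fun t ht => O.level_ne_level_succ hG hn heven ht) hup hdown ?_ ?_ ?_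
  · rw [← hmleft t₁ le_rfl]
    exact Nat.count_monotone _ (by omega)
  · rw [hN₁, hmN]
    omega
  · intro t ht
    have := hsame t (by
      rw [if_neg (by omega)]
      exact cutSet_eq_empty_of_forall_notMem fun U hU => hbefore U hU t ht)
    rwa [hmleft t ht] at this
  · intro i
    rcases le_or_gt (t₂ + 1 + i) N with hi | hi
    · rw [← hmright i hi]
      refine hsame _ ?_
      rw [if_pos (by omega)]
      refine cutSet_eq_empty_of_forall_mem fun U hU => ?_
      by_cases hUC : U = C
      · exact Or.inl hUC
      · exact Or.inr (hafter U hU hUC _ (by omega))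
    · rw [O.level_eq_zero_of_le hi.le, O₁.level_eq_zero_of_le (by omega)]
  · intro s hs hs₂
    -- `s` is the number of bricks of `K₁` placed before time `t`, at which the next one enters.
    have hsN : s < Nat.card (K₁.bricks n) := by omega
    have hsT := fun t => hO₁ (O₁.symm ⟨s, hsN⟩) t
    simp only [Equiv.apply_symm_apply] at hsT
    set t := r (O₁.symm ⟨s, hsN⟩) with ht
    have h1 : t < t₂ + 1 := (hsT _).1 hs₂
    have h2 : s < m (t + 1) := (hsT _).2 (Nat.lt_succ_self t)
    have h3 : ¬ s < m t := fun h' => lt_irrefl _ ((hsT _).1 h')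
    have h4 : m (t + 1) ≤ m t + 1 := by
      rw [hm, Nat.count_succ]
      split_ifs <;> omega
    have hst : m t = s := by omega
    have hle : m t ≤ t := Nat.count_le _
    refine ⟨t, by omega, by omega, ?_⟩
    rw [← hst, hlevel, hcutG]
    refine h.cut_lt_cut_glue hn1 ?_
    refine h.right.ncard_cutSet_subset_lt hn h.mem_right (hCX t) (T := (O.symm ⟨t₁, ht₁N⟩).1)
      (T' := (O.symm ⟨t₂, ht₂N⟩).1) hb₁ ?_ hb₂ hb₂C ?_ ?_
    · exact ⟨(O.symm ⟨t₁, ht₁N⟩).2, by rw [Subtype.coe_eta, O.val_apply_symm]; omega⟩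
    · rintro ⟨_, h'⟩
      rw [Subtype.coe_eta, O.val_apply_symm] at h'
      omega
    · simp only [ht₀]

theorem width_left_le (h : MeetAlong K₁ K₂ n C) (hn : 2 ≤ n) (heven : Even n)
    (hG : (glue K₁ K₂ C).IsPseudomanifold n) : h.left.width ≤ hG.width := by
  obtain ⟨O, hO⟩ := hG.exists_width_eq
  obtain ⟨O₁, hO₁⟩ := h.exists_ordering_width_lt hn heven O
  rw [hO]
  exact (h.left.width_le O₁).trans hO₁.le

theorem width_right_le (h : MeetAlong K₁ K₂ n C) (hn : 2 ≤ n) (heven : Even n)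
    (hG : (glue K₁ K₂ C).IsPseudomanifold n) : h.right.width ≤ hG.width := by
  have key : ∀ G, G = glue K₂ K₁ C → ∀ hG : G.IsPseudomanifold n, h.right.width ≤ hG.width := by
    rintro _ rfl hG
    exact h.symm.width_left_le hn heven hG
  exact key _ glue_comm hG

/-- An ordering of `K₁` with last brick `C` and an ordering of `K₂` with first brick `C` can be
concatenated to an ordering of the connected sum, with a local minimum at the junction. -/
theorem width_le_widthUnion (h : MeetAlong K₁ K₂ n C) (hn : 2 ≤ n) (heven : Even n)
    (hG : (glue K₁ K₂ C).IsPseudomanifold n) (O₁ : K₁.Ordering n) (O₂ : K₂.Ordering n)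
    (hO₁ : (O₁ ⟨C, h.mem_left⟩ : ℕ) = Nat.card (K₁.bricks n) - 1)
    (hO₂ : (O₂ ⟨C, h.mem_right⟩ : ℕ) = 0) : hG.width ≤ widthUnion O₁.width O₂.width := by
  classical
  have hn1 : 1 ≤ n := by omega
  have hmemG : ∀ {T}, T ∈ (glue K₁ K₂ C).bricks n ↔
      (T ∈ K₁.bricks n ∨ T ∈ K₂.bricks n) ∧ T ≠ C := mem_bricks_glue h.mem_left.2
  obtain ⟨h3, hpos, hlt⟩ := O₁.rev.level_one_lt_level_two h.left hn
  obtain ⟨h3', -, hlt'⟩ := O₂.level_one_lt_level_two h.right hn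
  rw [O₁.level_rev (by omega)] at hpos
  rw [O₁.level_rev (by omega), O₁.level_rev (by omega)] at hlt
  obtain ⟨p, hp⟩ : ∃ p, Nat.card (K₁.bricks n) = p + 1 := ⟨Nat.card (K₁.bricks n) - 1, by omega⟩
  obtain ⟨q, hq⟩ : ∃ q, Nat.card (K₂.bricks n) = q + 1 := ⟨Nat.card (K₂.bricks n) - 1, by omega⟩
  replace hO₁ : (O₁ ⟨C, h.mem_left⟩ : ℕ) = p := by omega
  rw [show Nat.card (K₁.bricks n) - 1 = p by omega] at hpos hlt
  rw [show Nat.card (K₁.bricks n) - 2 = p - 1 by omega] at hlt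
  have hB : ∀ T : (glue K₁ K₂ C).bricks n, T.1 ∉ K₁.bricks n → T.1 ∈ K₂.bricks n := fun T hT =>
    (hmemG.1 T.2).1.resolve_left hT
  -- In the concatenation, the bricks of `K₁` other than `C` occupy the positions below `p`, and `C`
  -- is skipped at the start of the ordering of `K₂`.
  set r : (glue K₁ K₂ C).bricks n → ℕ := fun T => if hT : T.1 ∈ K₁.bricks n then O₁ ⟨T.1, hT⟩
    else p + (O₂ ⟨T.1, hB T hT⟩ - 1) with hr
  have hr₁ : ∀ T, ∀ hT : T.1 ∈ K₁.bricks n, r T = O₁ ⟨T.1, hT⟩ := fun T hT => by simp [hr, hT]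
  have hr₂ : ∀ T, ∀ hT : T.1 ∈ K₂.bricks n, r T = p + (O₂ ⟨T.1, hT⟩ - 1) := fun T hT => by
    have : T.1 ∉ K₁.bricks n := fun hT' => (hmemG.1 T.2).2 (h.eq_of_mem hT' hT)
    simp [hr, this]
  have hlt₁ : ∀ T, (hT : T ∈ K₁.bricks n) → T ≠ C → (O₁ ⟨T, hT⟩ : ℕ) < p := by
    intro T hT hTC
    have h1 := (O₁ ⟨T, hT⟩).2
    have h2 : (O₁ ⟨T, hT⟩ : ℕ) ≠ p := fun e =>
      hTC (congrArg Subtype.val (O₁.injective (Fin.ext (e.trans hO₁.symm))))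
    omega
  have hlt₂ : ∀ T, (hT : T ∈ K₂.bricks n) → T ≠ C → 0 < (O₂ ⟨T, hT⟩ : ℕ) := by
    intro T hT hTC
    exact Nat.pos_of_ne_zero fun e =>
      hTC (congrArg Subtype.val (O₂.injective (Fin.ext (e.trans hO₂.symm))))
  have hrinj : Function.Injective r := by
    intro T T' hTT'
    have hTC := (hmemG.1 T.2).2
    have hTC' := (hmemG.1 T'.2).2
    by_cases hT : T.1 ∈ K₁.bricks n <;> by_cases hT' : T'.1 ∈ K₁.bricks n
    · rw [hr₁ T hT, hr₁ T' hT'] at hTT'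
      exact Subtype.ext (Subtype.mk.inj (O₁.injective (Fin.ext hTT')))
    · rw [hr₁ T hT, hr₂ T' (hB T' hT')] at hTT'
      have := hlt₁ T.1 hT hTC
      omega
    · rw [hr₂ T (hB T hT), hr₁ T' hT'] at hTT'
      have := hlt₁ T'.1 hT' hTC'
      omega
    · rw [hr₂ T (hB T hT), hr₂ T' (hB T' hT')] at hTT'
      have h1 := hlt₂ T.1 (hB T hT) hTC
      have h2 := hlt₂ T'.1 (hB T' hT') hTC'
      have h3 : (O₂ ⟨T.1, hB T hT⟩ : ℕ) = O₂ ⟨T'.1, hB T' hT'⟩ := by omega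
      exact Subtype.ext (Subtype.mk.inj (O₂.injective (Fin.ext h3)))
  have hrlt : ∀ T, r T < p + q := by
    intro T
    have hTC := (hmemG.1 T.2).2
    by_cases hT : T.1 ∈ K₁.bricks n
    · rw [hr₁ T hT]
      have := hlt₁ T.1 hT hTC
      omega
    · rw [hr₂ T (hB T hT)]
      have h1 := hlt₂ T.1 (hB T hT) hTC
      have h2 := (O₂ ⟨T.1, hB T hT⟩).2
      omega
  have hrsurj : ∀ x < p + q, ∃ T, r T = x := by
    intro x hx
    rcases lt_or_ge x p with hxp | hxp
    · set T := O₁.symm ⟨x, by omega⟩ with hT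
      have hOT : (O₁ T : ℕ) = x := by rw [hT, Equiv.apply_symm_apply]
      have hTC : T.1 ≠ C := by
        intro e
        have : T = ⟨C, h.mem_left⟩ := Subtype.ext e
        rw [this, hO₁] at hOT
        omega
      exact ⟨⟨T.1, hmemG.2 ⟨Or.inl T.2, hTC⟩⟩, (hr₁ ⟨T.1, _⟩ T.2).trans hOT⟩
    · set T := O₂.symm ⟨x - p + 1, by omega⟩ with hT
      have hOT : (O₂ T : ℕ) = x - p + 1 := by rw [hT, Equiv.apply_symm_apply]
      have hTC : T.1 ≠ C := by
        intro e
        have : T = ⟨C, h.mem_right⟩ := Subtype.ext e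
        rw [this, hO₂] at hOT
        omega
      refine ⟨⟨T.1, hmemG.2 ⟨Or.inr T.2, hTC⟩⟩, (hr₂ ⟨T.1, _⟩ T.2).trans ?_⟩
      change p + ((O₂ T : ℕ) - 1) = x
      omega
  obtain ⟨O, hO, hcard⟩ := exists_ordering_of_rank hG.finite_bricks r hrinj
  have hcount : ∀ t ≤ p + q, Nat.count (fun x => ∃ T, r T = x) t = t := fun t ht =>
    Nat.count_iff_forall.2 fun x hx => hrsurj x (by omega)
  have hN : Nat.card ((glue K₁ K₂ C).bricks n) = p + q := by
    rw [hcard (p + q) hrlt, hcount _ le_rfl]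
  have hOr : ∀ T, ∀ t ≤ p + q, (O T : ℕ) < t ↔ r T < t := by
    intro T t ht
    have := hO T t
    rwa [hcount t ht] at this
  have hC₁ : ∀ j ≤ p, C ∉ O₁.initial j := by
    rintro j hj ⟨_, hlt⟩
    omega
  have hleft : ∀ j ≤ p, O.level j = O₁.level j := by
    intro j hj
    have hK₂ : ∀ T ∈ K₂.bricks n, T ∉ O₁.initial j := by
      intro T hT hTX
      exact hC₁ j hj (h.eq_of_mem hTX.1 hT ▸ hTX)
    rw [O.level_eq_cut, O₁.level_eq_cut]
    unfold cut
    rw [cutSet_congr (Y := O₁.initial j), h.cutSet_glue hn1,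
      cutSet_eq_empty_of_forall_notMem hK₂, ← Set.bot_eq_empty, symmDiff_bot]
    intro T hT
    rw [O.mem_initial hT, hOr _ _ (by omega)]
    by_cases hT₁ : T ∈ K₁.bricks n
    · rw [hr₁ ⟨T, hT⟩ hT₁, O₁.mem_initial hT₁]
    · have hT₂ := hB ⟨T, hT⟩ hT₁
      rw [hr₂ ⟨T, hT⟩ hT₂]
      exact ⟨fun h' => by omega, fun h' => absurd h'.1 hT₁⟩
  have hright : ∀ i, O.level (p + i) = O₂.level (1 + i) := by
    intro i
    rcases le_or_gt i q with hi | hi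
    swap
    · rw [O.level_eq_zero_of_le (by omega), O₂.level_eq_zero_of_le (by omega)]
    rw [O.level_eq_cut, O₂.level_eq_cut]
    unfold cut
    rw [cutSet_congr (Y := O₂.initial (1 + i) ∪ K₁.bricks n), h.cutSet_glue hn1,
      cutSet_eq_empty_of_forall_mem (K := K₁) (X := O₂.initial (1 + i) ∪ K₁.bricks n)
        (fun T hT => Or.inr hT), ← Set.bot_eq_empty,
      bot_symmDiff]
    · congr 1
      refine cutSet_congr fun T hT => ?_
      rw [Set.mem_union, or_iff_left_of_imp]
      intro hT₁
      obtain rfl := h.eq_of_mem hT₁ hT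
      exact ⟨hT, by omega⟩
    · intro T hT
      have hTC := (hmemG.1 hT).2
      rw [O.mem_initial hT, hOr _ _ (by omega), Set.mem_union]
      by_cases hT₁ : T ∈ K₁.bricks n
      · rw [hr₁ ⟨T, hT⟩ hT₁]
        have := hlt₁ T hT₁ hTC
        change (O₁ ⟨T, hT₁⟩ : ℕ) < p + i ↔ _
        exact ⟨fun _ => Or.inr hT₁, fun _ => by omega⟩
      · have hT₂ : T ∈ K₂.bricks n := hB ⟨T, hT⟩ hT₁
        have := hlt₂ T hT₂ hTC
        rw [hr₂ ⟨T, hT⟩ hT₂, O₂.mem_initial hT₂, or_iff_left hT₁]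
        change p + ((O₂ ⟨T, hT₂⟩ : ℕ) - 1) < p + i ↔ _
        omega
  refine (hG.width_le O).trans ?_
  rw [O.width_eq_sort_peaks hG hn heven, O₁.width_eq_sort_peaks h.left hn heven,
    O₂.width_eq_sort_peaks h.right hn heven, widthUnion, Multiset.sort_eq, Multiset.sort_eq, hN,
    hp, hq, peaks_concat (by omega) hleft hright hlt ?_ hlt']
  rwa [O₁.level_eq_zero_of_le hp.le]

end MeetAlong

end PreAbstractSimplicialComplex

/-! ### Images under injective maps -/

namespace PreAbstractSimplicialComplex

universe u v

variable {α : Type u} {β : Type v} {n : ℕ}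

section Map

variable [DecidableEq β] {K : PreAbstractSimplicialComplex α} {f : α → β}

theorem mem_map {s : Finset β} : s ∈ K.map f ↔ ∃ t ∈ K, t.image f = s := Iff.rfl

theorem image_mem_map_iff (hf : Function.Injective f) {s : Finset α} :
    s.image f ∈ K.map f ↔ s ∈ K := by
  rw [mem_map]
  constructor
  · rintro ⟨t, ht, e⟩
    rwa [← Finset.image_injective hf e]
  · exact fun hs => ⟨s, hs, rfl⟩

theorem image_mem_bricks_map_iff (hf : Function.Injective f) {T : Finset α} :
    T.image f ∈ (K.map f).bricks n ↔ T ∈ K.bricks n :=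
  and_congr (image_mem_map_iff hf) (by rw [Finset.card_image_of_injective _ hf])

theorem image_mem_facets_map_iff (hf : Function.Injective f) {T : Finset α} :
    T.image f ∈ (K.map f).facets n ↔ T ∈ K.facets n :=
  and_congr (image_mem_map_iff hf) (by rw [Finset.card_image_of_injective _ hf])

theorem exists_of_mem_bricks_map (hf : Function.Injective f) {T : Finset β}
    (hT : T ∈ (K.map f).bricks n) : ∃ S ∈ K.bricks n, S.image f = T := by
  obtain ⟨S, -, rfl⟩ := mem_map.1 hT.1
  exact ⟨S, (image_mem_bricks_map_iff hf).1 hT, rfl⟩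

theorem exists_of_mem_facets_map (hf : Function.Injective f) {T : Finset β}
    (hT : T ∈ (K.map f).facets n) : ∃ S ∈ K.facets n, S.image f = T := by
  obtain ⟨S, -, rfl⟩ := mem_map.1 hT.1
  exact ⟨S, (image_mem_facets_map_iff hf).1 hT, rfl⟩

/-- The bricks of a complex correspond to those of its image under an injective map. -/
noncomputable def bricksMapEquiv (K : PreAbstractSimplicialComplex α) (n : ℕ)
    (hf : Function.Injective f) : K.bricks n ≃ (K.map f).bricks n :=
  Equiv.ofBijective (fun T => ⟨T.1.image f, (image_mem_bricks_map_iff hf).2 T.2⟩)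
    ⟨fun _ _ h => Subtype.ext (Finset.image_injective hf (Subtype.mk.inj h)), fun T => by
      obtain ⟨S, hS, e⟩ := exists_of_mem_bricks_map hf T.2
      exact ⟨⟨S, hS⟩, Subtype.ext e⟩⟩

theorem coe_bricksMapEquiv (hf : Function.Injective f) (T : K.bricks n) :
    (bricksMapEquiv K n hf T : Finset β) = T.1.image f := rfl

/-- An injective map induces an isomorphism of dual graphs. -/
noncomputable def dualGraphMapIso (K : PreAbstractSimplicialComplex α) (n : ℕ)
    (hf : Function.Injective f) : K.dualGraph n ≃g (K.map f).dualGraph n where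
  toEquiv := bricksMapEquiv K n hf
  map_rel_iff' := by
    intro T T'
    refine and_congr (bricksMapEquiv K n hf).injective.ne_iff ?_
    simp only [coe_bricksMapEquiv]
    constructor
    · rintro ⟨F, hF, h⟩
      obtain ⟨F, hF', rfl⟩ := exists_of_mem_facets_map hf hF
      rw [Finset.image_subset_image_iff hf, Finset.image_subset_image_iff hf] at h
      exact ⟨F, hF', h⟩
    · rintro ⟨F, hF, h⟩
      exact ⟨F.image f, (image_mem_facets_map_iff hf).2 hF, Finset.image_subset_image h.1,
        Finset.image_subset_image h.2⟩

theorem IsPseudomanifold.map (h : K.IsPseudomanifold n) (hf : Function.Injective f) :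
    (K.map f).IsPseudomanifold n where
  finite := h.finite.image _
  nonempty := by
    obtain ⟨T, hT⟩ := h.nonempty
    exact ⟨_, (image_mem_bricks_map_iff hf).2 hT⟩
  exists_brick := by
    rintro s hs
    obtain ⟨t, ht, rfl⟩ := mem_map.1 hs
    obtain ⟨T, hT, htT⟩ := h.exists_brick t ht
    exact ⟨_, (image_mem_bricks_map_iff hf).2 hT, Finset.image_subset_image htT⟩
  two_bricks := by
    intro F hF
    obtain ⟨F, hF', rfl⟩ := exists_of_mem_facets_map hf hF
    rw [← h.two_bricks F hF', ← Set.ncard_image_of_injective _ (Finset.image_injective hf)]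
    congr 1
    ext T
    constructor
    · rintro ⟨hT, hFT⟩
      obtain ⟨T, hT', rfl⟩ := exists_of_mem_bricks_map hf hT
      exact ⟨T, ⟨hT', (Finset.image_subset_image_iff hf).1 hFT⟩, rfl⟩
    · rintro ⟨T, ⟨hT, hFT⟩, rfl⟩
      exact ⟨(image_mem_bricks_map_iff hf).2 hT, Finset.image_subset_image hFT⟩
  stronglyConnected := (dualGraphMapIso K n hf).connected_iff.1 h.stronglyConnected

/-- The orderings of a complex correspond to those of its image under an injective map. -/
noncomputable def orderingMapEquiv (K : PreAbstractSimplicialComplex α) (n : ℕ)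
    (hf : Function.Injective f) : K.Ordering n ≃ (K.map f).Ordering n :=
  Equiv.equivCongr (bricksMapEquiv K n hf) (finCongr (Nat.card_congr (bricksMapEquiv K n hf)))

theorem orderingMapEquiv_apply (hf : Function.Injective f) (O : K.Ordering n) (T : K.bricks n) :
    (orderingMapEquiv K n hf O (bricksMapEquiv K n hf T) : ℕ) = O T := by
  change (O ((bricksMapEquiv K n hf).symm (bricksMapEquiv K n hf T)) : ℕ) = O T
  rw [Equiv.symm_apply_apply]

theorem level_orderingMapEquiv (hf : Function.Injective f) (O : K.Ordering n) (j : ℕ) :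
    (orderingMapEquiv K n hf O).level j = O.level j := by
  unfold Ordering.level
  rw [← Set.ncard_image_of_injective (O.levelSet j) (Finset.image_injective hf)]
  congr 1
  ext F
  constructor
  · rintro ⟨hF, ⟨T, hT, hFT⟩, T', hT', hFT'⟩
    obtain ⟨F, hF', rfl⟩ := exists_of_mem_facets_map hf hF
    obtain ⟨T, rfl⟩ := (bricksMapEquiv K n hf).surjective T
    obtain ⟨T', rfl⟩ := (bricksMapEquiv K n hf).surjective T'
    rw [orderingMapEquiv_apply] at hT hT'
    rw [coe_bricksMapEquiv, Finset.image_subset_image_iff hf] at hFT hFT'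
    exact ⟨F, ⟨hF', ⟨T, hT, hFT⟩, T', hT', hFT'⟩, rfl⟩
  · rintro ⟨F, ⟨hF, ⟨T, hT, hFT⟩, T', hT', hFT'⟩, rfl⟩
    exact ⟨(image_mem_facets_map_iff hf).2 hF,
      ⟨bricksMapEquiv K n hf T, by rwa [orderingMapEquiv_apply], Finset.image_subset_image hFT⟩,
      bricksMapEquiv K n hf T', by rwa [orderingMapEquiv_apply], Finset.image_subset_image hFT'⟩

theorem width_orderingMapEquiv (hf : Function.Injective f) (O : K.Ordering n) :
    (orderingMapEquiv K n hf O).width = O.width := by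
  classical
  have hl : (orderingMapEquiv K n hf O).level = O.level := funext (level_orderingMapEquiv hf O)
  have hN : Nat.card ((K.map f).bricks n) = Nat.card (K.bricks n) :=
    Nat.card_congr (bricksMapEquiv K n hf).symm
  have hm : (orderingMapEquiv K n hf O).IsMaximum = O.IsMaximum := by
    funext t
    unfold Ordering.IsMaximum
    rw [hl, hN]
  unfold Ordering.width
  rw [hl, hN]
  refine congrArg (fun s : Finset ℕ => (s.val.map O.level).sort (· ≥ ·)) ?_
  ext t
  rw [Finset.mem_filter, Finset.mem_filter, hm]

theorem IsPseudomanifold.width_map (h : K.IsPseudomanifold n) (hf : Function.Injective f)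
    (h' : (K.map f).IsPseudomanifold n) : h'.width = h.width := by
  apply le_antisymm
  · obtain ⟨O, hO⟩ := h.exists_width_eq
    rw [hO, ← width_orderingMapEquiv hf]
    exact h'.width_le _
  · obtain ⟨O, hO⟩ := h'.exists_width_eq
    obtain ⟨O, rfl⟩ := (orderingMapEquiv K n hf).surjective O
    rw [hO, width_orderingMapEquiv]
    exact h.width_le O

theorem remove_map (hf : Function.Injective f) (C : Finset α) :
    (K.remove C).map f = (K.map f).remove (C.image f) := by
  ext s
  constructor
  · rintro ⟨t, ⟨ht, hCt⟩, rfl⟩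
    exact ⟨⟨t, ht, rfl⟩, fun h => hCt ((Finset.image_subset_image_iff hf).1 h)⟩
  · rintro ⟨⟨t, ht, rfl⟩, hCt⟩
    exact ⟨t, ⟨ht, fun h => hCt (Finset.image_subset_image h)⟩, rfl⟩

end Map

/-! ### The connected sum -/

section ConnectedSum

variable {C₁ : Finset α} {C₂ : Finset β} (φ : C₁ ≃ C₂)

theorem glueVertex_of_mem {b : β} (hb : b ∈ C₂) :
    glueVertex φ b = Sum.inl (φ.symm ⟨b, hb⟩).1 := dif_pos hb

theorem glueVertex_of_notMem {b : β} (hb : b ∉ C₂) : glueVertex φ b = Sum.inr ⟨b, hb⟩ := dif_neg hb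

theorem glueVertex_injective : Function.Injective (glueVertex φ) := by
  intro b b' h
  by_cases hb : b ∈ C₂ <;> by_cases hb' : b' ∈ C₂
  · rw [glueVertex_of_mem φ hb, glueVertex_of_mem φ hb'] at h
    exact Subtype.mk.inj (φ.symm.injective (Subtype.ext (Sum.inl_injective h)))
  · rw [glueVertex_of_mem φ hb, glueVertex_of_notMem φ hb'] at h
    exact absurd h Sum.inl_ne_inr
  · rw [glueVertex_of_notMem φ hb, glueVertex_of_mem φ hb'] at h
    exact absurd h Sum.inr_ne_inl
  · rw [glueVertex_of_notMem φ hb, glueVertex_of_notMem φ hb'] at h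
    exact Subtype.mk.inj (Sum.inr_injective h)

open Classical in
theorem image_glueVertex :
    C₂.image (glueVertex φ) = C₁.image Sum.inl := by
  ext x
  rw [Finset.mem_image, Finset.mem_image]
  constructor
  · rintro ⟨b, hb, rfl⟩
    exact ⟨_, (φ.symm ⟨b, hb⟩).2, (glueVertex_of_mem φ hb).symm⟩
  · rintro ⟨a, ha, rfl⟩
    refine ⟨φ ⟨a, ha⟩, (φ ⟨a, ha⟩).2, ?_⟩
    rw [glueVertex_of_mem φ (φ ⟨a, ha⟩).2, Subtype.coe_eta, Equiv.symm_apply_apply]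

open Classical in
theorem connectedSum_eq_glue (K₁ : PreAbstractSimplicialComplex α)
    (K₂ : PreAbstractSimplicialComplex β) :
    connectedSum K₁ K₂ φ =
      glue (K₁.map Sum.inl) (K₂.map (glueVertex φ)) (C₁.image Sum.inl) := by
  unfold connectedSum glue
  rw [remove_map Sum.inl_injective, remove_map (glueVertex_injective φ), image_glueVertex]

open Classical in
/-- Inside the glued vertex set, the two complexes have the faces of the glued brick in common. -/
theorem meetAlong_map {K₁ : PreAbstractSimplicialComplex α} {K₂ : PreAbstractSimplicialComplex β}
    (h₁ : K₁.IsPseudomanifold n) (h₂ : K₂.IsPseudomanifold n) (hC₁ : C₁ ∈ K₁.bricks n)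
    (hC₂ : C₂ ∈ K₂.bricks n) :
    MeetAlong (K₁.map (Sum.inl : α → α ⊕ {b : β // b ∉ C₂})) (K₂.map (glueVertex φ)) n
      (C₁.image Sum.inl) where
  left := h₁.map Sum.inl_injective
  right := h₂.map (glueVertex_injective φ)
  mem_left := (image_mem_bricks_map_iff Sum.inl_injective).2 hC₁
  mem_right := by
    rw [← image_glueVertex φ]
    exact (image_mem_bricks_map_iff (glueVertex_injective φ)).2 hC₂
  subset := by
    intro s hs₁ hs₂ x hx
    obtain ⟨t₁, -, e₁⟩ := mem_map.1 hs₁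
    obtain ⟨t₂, -, e₂⟩ := mem_map.1 hs₂
    obtain ⟨a, -, ha⟩ := Finset.mem_image.1 (e₁ ▸ hx)
    obtain ⟨b, -, hb⟩ := Finset.mem_image.1 (e₂ ▸ hx)
    by_cases hbC : b ∈ C₂
    · rw [← image_glueVertex φ, ← hb]
      exact Finset.mem_image_of_mem _ hbC
    · rw [glueVertex_of_notMem φ hbC, ← ha] at hb
      exact absurd hb Sum.inr_ne_inl

end ConnectedSum

end PreAbstractSimplicialComplex

theorem mainTheorem4 {α : Type*} {β : Type*} (n : ℕ) (hn : 2 ≤ n) (heven : Even n)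
    (V₁ : PreAbstractSimplicialComplex α) (V₂ : PreAbstractSimplicialComplex β)
    (h₁ : V₁.IsPseudomanifold n) (h₂ : V₂.IsPseudomanifold n) :
    ∃ C₁ ∈ V₁.bricks n, ∃ C₂ ∈ V₂.bricks n, ∃ φ : C₁ ≃ C₂,
      ∃ h : (PreAbstractSimplicialComplex.connectedSum V₁ V₂ φ).IsPseudomanifold n,
        max h₁.width h₂.width ≤ h.width ∧
          h.width ≤ PreAbstractSimplicialComplex.widthUnion h₁.width h₂.width := by
  classical
  obtain ⟨O₁, hO₁⟩ := h₁.exists_width_eq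
  obtain ⟨O₂, hO₂⟩ := h₂.exists_width_eq
  have hN₁ := (O₁.level_one_lt_level_two h₁ hn).1
  have hN₂ := (O₂.level_one_lt_level_two h₂ hn).1
  -- Glue the last brick of an optimal ordering to the first brick of an optimal ordering.
  set B₁ := O₁.symm ⟨Nat.card (V₁.bricks n) - 1, by omega⟩ with hB₁
  set B₂ := O₂.symm ⟨0, by omega⟩ with hB₂
  let φ : B₁.1 ≃ B₂.1 := Finset.equivOfCardEq (by rw [B₁.2.2, B₂.2.2])
  have hM := PreAbstractSimplicialComplex.meetAlong_map φ h₁ h₂ B₁.2 B₂.2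
  have hG := hM.isPseudomanifold_glue (by omega)
  have hw₁ := h₁.width_map Sum.inl_injective hM.left
  have hw₂ := h₂.width_map (PreAbstractSimplicialComplex.glueVertex_injective φ) hM.right
  refine ⟨B₁, B₁.2, B₂, B₂.2, φ, ?_⟩
  rw [PreAbstractSimplicialComplex.connectedSum_eq_glue]
  refine ⟨hG, max_le ?_ ?_, ?_⟩
  · rw [← hw₁]
    exact hM.width_left_le hn heven hG
  · rw [← hw₂]
    exact hM.width_right_le hn heven hG
  · rw [hO₁, hO₂, ← PreAbstractSimplicialComplex.width_orderingMapEquiv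
        (Sum.inl_injective (α := α) (β := {b : β // b ∉ B₂.1})) O₁,
      ← PreAbstractSimplicialComplex.width_orderingMapEquiv
        (PreAbstractSimplicialComplex.glueVertex_injective φ) O₂]
    refine hM.width_le_widthUnion hn heven hG _ _ ?_ ?_
    · refine (PreAbstractSimplicialComplex.orderingMapEquiv_apply Sum.inl_injective O₁ B₁).trans ?_
      rw [hB₁, O₁.val_apply_symm]
      exact (congrArg (· - 1) (Nat.card_congr
        (PreAbstractSimplicialComplex.bricksMapEquiv V₁ n Sum.inl_injective)))
    · have e : (⟨B₁.1.image Sum.inl, hM.mem_right⟩ : (V₂.map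
          (PreAbstractSimplicialComplex.glueVertex φ)).bricks n) =
          PreAbstractSimplicialComplex.bricksMapEquiv V₂ n
            (PreAbstractSimplicialComplex.glueVertex_injective φ) B₂ :=
        Subtype.ext (PreAbstractSimplicialComplex.image_glueVertex φ).symm
      rw [e, PreAbstractSimplicialComplex.orderingMapEquiv_apply, hB₂, O₂.val_apply_symm]
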